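/- Let $H_3$ be the $3$-dimensional Heisenberg group, whose Lie algebra $\mathfrak n$ has a basis $E_1,E_2,E_3$ with the only nontrivial bracket $[E_1,E_2]=E_3$, and let $G=H_3\rtimes SO(2)$ act on $H_3=G/H$, $H=SO(2)$, where $\mathfrak h=\mathrm{span}(D)$, $D(E_1)=E_2$, $D(E_2)=-E_1$, $D(E_3)=0$. Write $p$ for the identity of $H_3$, $T_pH_3=\mathfrak n$, $\mathfrak g=\mathfrak h+\mathfrak n$. For $c>0$ let $g_c$ be the invariant Riemannian metric on $H_3$ given by the scalar product on $\mathfrak n$ with $E_1,E_2,E_3$ orthogonal, $\langle E_1,E_1\rangle=\langle E_2,E_2\rangle=1$, $\langle E_3,E_3\rangle=c$. Let $c_1\ne c_2$ be positive and put $F_i(y)=\sqrt{g_{c_i}(y,y)}=\sqrt{y_1^2+y_2^2+c_iy_3^2}$ for $y=y_1E_1+y_2E_2+y_3E_3$. Call $L\colon[0,\infty)^2\to\mathbb R$ admissible if it is continuous, positively homogeneous of degree $2$, and, on $(0,\infty)^2$, it is smooth and positive, has partial derivatives $L_{,1},L_{,2}\ge0$ with $L_{,1}+L_{,2}>0$,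 and has positive semidefinite Hessian. A $G$-invariant Finsler metric $F$ on $H_3$ is geodesic orbit (g.o.) if every geodesic $\gamma$ with $\gamma(0)=p$ has the form $\gamma(t)=\exp(tX)(p)$ with $X\in\mathfrak g$; it is naturally reductive if there is one reductive decomposition $\mathfrak g=\mathfrak h+\mathfrak m$ such that $X$ can always be chosen in $\mathfrak m$. A geodesic graph is an $\mathrm{Ad}(H)$-equivariant map $\mathfrak n\to\mathfrak h$, $y\mapsto\xi_1(y)D$, such that $t\mapsto\exp(t(y+\xi_1(y)D))(p)$ is a geodesic for every $y\ne0$. An $\mathrm{Ad}(H)$-invariant norm $F$ on $\mathfrak n$ is of $(\alpha_1,\alpha_2)$-type if $F(y)=f(\alpha_1(y_{\mathfrak m_1},y_{\mathfrak m_1}),\alpha_2(y_{\mathfrak m_2},y_{\mathfrak m_2}))$ for an $\mathrm{Ad}(H)$-irreducible decomposition $\mathfrak n=\mathfrak m_1\oplus\mathfrak m_2$, $\mathrm{Ad}(H)$-invariant scalar products $\alpha_i$ on $\mathfrak m_i$, and a function $f$ continuous on $[0,\infty)^2$ and smooth on $[0,\infty)^2\setminus\{0\}$. Then: 1. The Riemannian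 metrics $g_{c_1}$ and $g_{c_2}$ are naturally reductive: for each $i$ there is a reductive decomposition $\mathfrak g=\mathfrak h+\mathfrak m$ with $\langle[z,x]_{\mathfrak m},y\rangle+\langle x,[z,y]_{\mathfrak m}\rangle=0$ for all $x,y,z\in\mathfrak m$. 2. For every admissible $L$, the function $F=\sqrt{L(F_1,F_2)}$ on $\mathfrak n$ determines a $G$-invariant Finsler metric on $H_3$, which is of $(\alpha_1,\alpha_2)$-type and geodesic orbit. It has a geodesic graph $$\xi_1(y)=\frac{c_1B_1+c_2B_2}{B_1+B_2}\,y_3\quad(y\ne 0),\qquad \xi_1(0)=0,\qquad B_i=\frac{L_{,i}(F_1(y),F_2(y))}{F_i(y)},$$ which is continuous, and with which every geodesic graph agrees at all $y$ with $(y_1,y_2)\ne(0,0)$. If this map is not linear, then $F$ is not naturally reductive. 3. The function $L(a,b)=(a^3+b^3)^{2/3}$ is admissible and gives $F=(F_1^3+F_2^3)^{1/3}$. Its geodesic graph, unique in the same sense, is $$\xi_1(y)=\frac{c_1F_1(y)+c_2F_2(y)}{F_1(y)+F_2(y)}\,y_3\quad(y\ne0),\qquad \xi_1(0)=0.$$ No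 geodesic graph of this $F$ is linear, and $F$ is not naturally reductive. -/

import Mathlib

open scoped ContDiff

noncomputable section

namespace HeisFinsler

/-! The Heisenberg group, the rotation group and their semidirect product. -/

/-- The `3`-dimensional Heisenberg group `H₃`, in exponential coordinates with respect to the basis
`E₁, E₂, E₃` of its Lie algebra. As a manifold it is `ℝ³`; as a vector space it is the model of
every tangent space, and the tangent space at the identity is the Lie algebra `𝔫` of `H₃`. -/
def Heis : Type := Fin 3 → ℝ

instance : NormedAddCommGroup Heis := inferInstanceAs (NormedAddCommGroup (Fin 3 → ℝ))
instance : NormedSpace ℝ Heis := inferInstanceAs (NormedSpace ℝ (Fin 3 → ℝ))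
instance : FiniteDimensional ℝ Heis := inferInstanceAs (FiniteDimensional ℝ (Fin 3 → ℝ))

@[ext] theorem Heis.ext {x y : Heis} (h0 : x 0 = y 0) (h1 : x 1 = y 1) (h2 : x 2 = y 2) :
    x = y := by
  funext i
  fin_cases i <;> assumption

/-- The product `x · y = x + y + ½ [x, y]` with `[E₁, E₂] = E₃`. -/
instance : Mul Heis where
  mul x y := ![x 0 + y 0, x 1 + y 1, x 2 + y 2 + (x 0 * y 1 - x 1 * y 0) / 2]

instance : One Heis where
  one := ![0, 0, 0]

instance : Inv Heis where
  inv x := ![-x 0, -x 1, -x 2]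

@[simp] theorem heis_mul_zero (x y : Heis) : (x * y) 0 = x 0 + y 0 := rfl
@[simp] theorem heis_mul_one (x y : Heis) : (x * y) 1 = x 1 + y 1 := rfl
@[simp] theorem heis_mul_two (x y : Heis) :
    (x * y) 2 = x 2 + y 2 + (x 0 * y 1 - x 1 * y 0) / 2 := rfl
@[simp] theorem heis_one_zero : (1 : Heis) 0 = 0 := rfl
@[simp] theorem heis_one_one : (1 : Heis) 1 = 0 := rfl
@[simp] theorem heis_one_two : (1 : Heis) 2 = 0 := rfl
@[simp] theorem heis_inv_zero (x : Heis) : x⁻¹ 0 = -x 0 := rfl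
@[simp] theorem heis_inv_one (x : Heis) : x⁻¹ 1 = -x 1 := rfl
@[simp] theorem heis_inv_two (x : Heis) : x⁻¹ 2 = -x 2 := rfl
@[simp] theorem heis_add_apply (x y : Heis) (i : Fin 3) : (x + y) i = x i + y i := rfl
@[simp] theorem heis_smul_apply (r : ℝ) (x : Heis) (i : Fin 3) : (r • x) i = r * x i := rfl

instance : Group Heis where
  mul_assoc x y z := by ext <;> simp <;> ring
  one_mul x := by ext <;> simp
  mul_one x := by ext <;> simp
  inv_mul_cancel x := by ext <;> simp; ring

/-- The rotation group `SO(2)`. -/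
abbrev SO2 : Type := Matrix.specialOrthogonalGroup (Fin 2) ℝ

theorem SO2.det_eq (R : SO2) : R.1 0 0 * R.1 1 1 - R.1 0 1 * R.1 1 0 = 1 := by
  have h := (Matrix.mem_specialOrthogonalGroup_iff.1 R.2).2
  rwa [Matrix.det_fin_two] at h

/-- The rotation `R` acting on the plane spanned by `E₁, E₂` and fixing `E₃`. -/
def rotFun (R : SO2) (x : Heis) : Heis :=
  ![R.1 0 0 * x 0 + R.1 0 1 * x 1, R.1 1 0 * x 0 + R.1 1 1 * x 1, x 2]

@[simp] theorem rotFun_zero (R : SO2) (x : Heis) :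
    rotFun R x 0 = R.1 0 0 * x 0 + R.1 0 1 * x 1 := rfl
@[simp] theorem rotFun_one (R : SO2) (x : Heis) :
    rotFun R x 1 = R.1 1 0 * x 0 + R.1 1 1 * x 1 := rfl
@[simp] theorem rotFun_two (R : SO2) (x : Heis) : rotFun R x 2 = x 2 := rfl

theorem rotFun_one_left (x : Heis) : rotFun 1 x = x := by
  ext <;> simp

theorem rotFun_mul (R S : SO2) (x : Heis) : rotFun (R * S) x = rotFun R (rotFun S x) := by
  ext <;> simp [Matrix.mul_apply, Fin.sum_univ_two] <;> ring

/-- `SO(2)` acts on `H₃` by automorphisms. -/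
def rot : SO2 →* MulAut Heis where
  toFun R :=
    { toFun := rotFun R
      invFun := rotFun R⁻¹
      left_inv := fun x => by rw [← rotFun_mul, inv_mul_cancel, rotFun_one_left]
      right_inv := fun x => by rw [← rotFun_mul, mul_inv_cancel, rotFun_one_left]
      map_mul' := fun x y => by
        ext
        · simp; ring
        · simp; ring
        · simp only [rotFun_two, heis_mul_two, rotFun_zero, rotFun_one]
          linear_combination (-(x 0 * y 1 - x 1 * y 0) / 2) * R.det_eq }
  map_one' := MulEquiv.ext rotFun_one_left
  map_mul' R S := MulEquiv.ext (rotFun_mul R S)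

@[simp] theorem rot_apply (R : SO2) (x : Heis) : rot R x = rotFun R x := rfl

/-- The group `G = H₃ ⋊ SO(2)`. -/
abbrev G : Type := Heis ⋊[rot] SO2

/-- The action of `G = H₃ ⋊ SO(2)` on `H₃`: the first factor acts by left translations and the
second one by automorphisms. -/
instance : MulAction G Heis where
  smul g x := g.left * rot g.right x
  one_smul x := by
    change (1 : G).left * rot (1 : G).right x = x
    simp
  mul_smul g h x := by
    change (g * h).left * rot (g * h).right x = g.left * rot g.right (h.left * rot h.right x)
    simp only [SemidirectProduct.mul_left, SemidirectProduct.mul_right, map_mul, MulAut.mul_apply,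
      mul_assoc]

theorem heis_smul_def (g : G) (x : Heis) : g • x = g.left * rot g.right x := rfl

/-- The action is transitive. -/
instance : MulAction.IsPretransitive G Heis where
  exists_smul_eq x y := ⟨SemidirectProduct.inl (y * x⁻¹), by simp [heis_smul_def]⟩

/-- The isotropy group of the identity `p` of `H₃` is `SO(2)`; thus `H₃ = (H₃ ⋊ SO(2)) / SO(2)`. -/
theorem heis_stabilizer_one :
    MulAction.stabilizer G (1 : Heis) = (SemidirectProduct.inr : SO2 →* G).range := by
  ext g
  simp only [MulAction.mem_stabilizer_iff, heis_smul_def, map_one, mul_one, MonoidHom.mem_range]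
  constructor
  · intro h
    exact ⟨g.right, SemidirectProduct.ext h.symm rfl⟩
  · rintro ⟨R, rfl⟩
    rfl

/-! The Lie algebra `𝔤 = 𝔫 + 𝔥` of `G`. -/

/-- The Lie algebra `𝔤` of `G`; the pair `(y, a)` is the vector
`y₁ E₁ + y₂ E₂ + y₃ E₃ + a D`. -/
def LieG : Type := Heis × ℝ

instance : AddCommGroup LieG := inferInstanceAs (AddCommGroup (Heis × ℝ))
instance : Module ℝ LieG := inferInstanceAs (Module ℝ (Heis × ℝ))

/-- The component in `𝔫`. Since its kernel is the isotropy algebra `𝔥`, this is also the projection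
`𝔤 → 𝔤 / 𝔥 = T_p H₃`, which sends `X` to the velocity of `exp (tX) p` at `t = 0`. -/
def LieG.fst : LieG →ₗ[ℝ] Heis := LinearMap.fst ℝ Heis ℝ

/-- The component along `D`. -/
def LieG.snd : LieG →ₗ[ℝ] ℝ := LinearMap.snd ℝ Heis ℝ

/-- The vector `y + a D`. -/
def LieG.mk (y : Heis) (a : ℝ) : LieG := (y, a)

@[ext] theorem LieG.ext {X Y : LieG} (h0 : X.fst 0 = Y.fst 0) (h1 : X.fst 1 = Y.fst 1)
    (h2 : X.fst 2 = Y.fst 2) (h3 : X.snd = Y.snd) : X = Y :=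
  Prod.ext (Heis.ext h0 h1 h2) h3

@[simp] theorem LieG.fst_mk (y : Heis) (a : ℝ) : (LieG.mk y a).fst = y := rfl
@[simp] theorem LieG.snd_mk (y : Heis) (a : ℝ) : (LieG.mk y a).snd = a := rfl

/-- The bracket of `𝔤`, determined by `[E₁, E₂] = E₃`, `[D, E₁] = E₂`, `[D, E₂] = -E₁` and
`[E₁, E₃] = [E₂, E₃] = [D, E₃] = 0`. -/
instance : Bracket LieG LieG where
  bracket X Y := LieG.mk
    ![Y.snd * X.fst 1 - X.snd * Y.fst 1,
      X.snd * Y.fst 0 - Y.snd * X.fst 0,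
      X.fst 0 * Y.fst 1 - X.fst 1 * Y.fst 0] 0

@[simp] theorem bracket_fst_zero (X Y : LieG) :
    (⁅X, Y⁆ : LieG).fst 0 = Y.snd * X.fst 1 - X.snd * Y.fst 1 := rfl
@[simp] theorem bracket_fst_one (X Y : LieG) :
    (⁅X, Y⁆ : LieG).fst 1 = X.snd * Y.fst 0 - Y.snd * X.fst 0 := rfl
@[simp] theorem bracket_fst_two (X Y : LieG) :
    (⁅X, Y⁆ : LieG).fst 2 = X.fst 0 * Y.fst 1 - X.fst 1 * Y.fst 0 := rfl
@[simp] theorem bracket_snd (X Y : LieG) : (⁅X, Y⁆ : LieG).snd = 0 := rfl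

theorem Heis.zero_apply (i : Fin 3) : (0 : Heis) i = 0 := rfl

instance : LieRing LieG where
  add_lie X Y Z := by ext <;> simp <;> ring
  lie_add X Y Z := by ext <;> simp <;> ring
  lie_self X := by
    ext <;> simp [Heis.zero_apply]
    ring
  leibniz_lie X Y Z := by ext <;> simp <;> ring

instance : LieAlgebra ℝ LieG where
  lie_smul r X Y := by ext <;> simp <;> ring

/-- The isotropy algebra `𝔥 = span (D)`. -/
def isotropyAlgebra : Submodule ℝ LieG := LinearMap.ker LieG.fst

/-- The adjoint representation of `H = SO(2)` on `𝔤`. On `𝔫` it is `rotFun`, and it fixes `D`. -/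
def Ad (R : SO2) (X : LieG) : LieG := LieG.mk (rotFun R X.fst) X.snd

/-- `φ` is the one-parameter subgroup `t ↦ exp (tX)` of `G = H₃ ⋊ SO(2)`: a homomorphism from `ℝ`
to `G` whose velocity at `0` is `X = y + a D`, where `D` is the infinitesimal rotation
`D(E₁) = E₂`, `D(E₂) = -E₁`. -/
structure IsOneParameterSubgroup (φ : ℝ → G) (X : LieG) : Prop where
  map_add : ∀ s t, φ (s + t) = φ s * φ t
  velocity_left : HasDerivAt (fun t => (φ t).left) X.fst 0
  velocity_right : ∀ i j : Fin 2,
    HasDerivAt (fun t => (φ t).right.1 i j)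
      (X.snd * (!![0, -1; 1, 0] : Matrix (Fin 2) (Fin 2) ℝ) i j) 0

/-- `Ad` is the adjoint representation: `h exp (tX) h⁻¹ = exp (t Ad(h) X)` for `h` in `SO(2)`. -/
theorem IsOneParameterSubgroup.conj {φ : ℝ → G} {X : LieG} (hφ : IsOneParameterSubgroup φ X)
    (R : SO2) : IsOneParameterSubgroup
      (fun t => SemidirectProduct.inr R * φ t * (SemidirectProduct.inr R)⁻¹) (Ad R X) where
  map_add s t := by simp only [hφ.map_add]; group
  velocity_left := by
    have h := fun i => (hasDerivAt_pi.1 (show HasDerivAt (fun t => ((φ t).left : Fin 3 → ℝ))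
      X.fst 0 from hφ.velocity_left)) i
    refine (hasDerivAt_pi (φ := fun t i => ((SemidirectProduct.inr R * φ t *
      (SemidirectProduct.inr R)⁻¹ : G).left : Fin 3 → ℝ) i)).2 fun i => ?_
    fin_cases i
    · simpa [Ad] using ((h 0).const_mul (R.1 0 0)).fun_add ((h 1).const_mul (R.1 0 1))
    · simpa [Ad] using ((h 0).const_mul (R.1 1 0)).fun_add ((h 1).const_mul (R.1 1 1))
    · simpa [Ad] using h 2
  velocity_right := by
    have hc : ∀ A B : SO2, A * B = B * A := by
      intro A B
      have hA := Matrix.mem_specialOrthogonalGroup_fin_two_iff.1 A.2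
      have hB := Matrix.mem_specialOrthogonalGroup_fin_two_iff.1 B.2
      apply Subtype.ext
      ext i j
      fin_cases i <;> fin_cases j <;>
        simp [Matrix.mul_apply, Fin.sum_univ_two, hA.1, hA.2.1, hB.1, hB.2.1] <;> ring
    intro i j
    have he : ∀ t, (SemidirectProduct.inr R * φ t * (SemidirectProduct.inr R)⁻¹ : G).right
        = (φ t).right := by
      intro t
      simp [hc R (φ t).right]
    simp only [he]
    exact hφ.velocity_right i j

/-- A reductive decomposition `𝔤 = 𝔥 + 𝔪`: an `Ad(H)`-invariant complement `𝔪` of `𝔥`. -/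
def IsReductive (m : Submodule ℝ LieG) : Prop :=
  IsCompl isotropyAlgebra m ∧ ∀ (R : SO2), ∀ X ∈ m, Ad R X ∈ m

/-! Homogeneous Finsler metrics and their geodesics. -/

/-- `F (x, v)`, with `x` in `H₃` and `v` in `T_x H₃`, is a Finsler metric on `H₃` that is invariant
under `G = H₃ ⋊ SO(2)`. -/
structure IsHomogeneousFinsler (F : Heis → Heis → ℝ) : Prop where
  smooth : ContDiffOn ℝ ∞ (fun q : Heis × Heis => F q.1 q.2) {q | q.2 ≠ 0}
  pos : ∀ x v, v ≠ 0 → 0 < F x v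
  homogeneous : ∀ x v, ∀ r : ℝ, 0 ≤ r → F x (r • v) = r * F x v
  fundamental_pos : ∀ x v, v ≠ 0 → ∀ w, w ≠ 0 →
    0 < iteratedFDeriv ℝ 2 (fun u => F x u ^ 2 / 2) v ![w, w]
  invariant : ∀ (g : G) (x v : Heis), F (g • x) (fderiv ℝ (fun z : Heis => g • z) x v) = F x v

/-- The metric on `H₃` obtained from a norm `N` on `T_p H₃ = 𝔫` by left translations. -/
def invariantMetric (N : Heis → ℝ) (x v : Heis) : ℝ :=
  N (fderiv ℝ (fun z : Heis => x⁻¹ * z) x v)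

/-- `γ` is a geodesic of `F` on the open interval `I`: a regular smooth curve which satisfies the
Euler-Lagrange equations of the energy `F² / 2`. -/
structure IsGeodesicOn (F : Heis → Heis → ℝ) (γ : ℝ → Heis) (I : Set ℝ) : Prop where
  smooth : ContDiffOn ℝ ∞ γ I
  regular : ∀ t ∈ I, deriv γ t ≠ 0
  euler_lagrange : ∀ t ∈ I, ∀ w : Heis,
    HasDerivAt (fun s => fderiv ℝ (fun v => F (γ s) v ^ 2 / 2) (deriv γ s) w)
      (fderiv ℝ (fun x => F x (deriv γ t) ^ 2 / 2) (γ t) w) t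

/-- On `I`, the curve `γ` is the orbit `γ(t) = exp (tX) (p)` of the identity `p` of `H₃`. -/
def IsOrbitOn (γ : ℝ → Heis) (X : LieG) (I : Set ℝ) : Prop :=
  ∃ φ : ℝ → G, IsOneParameterSubgroup φ X ∧ ∀ t ∈ I, γ t = φ t • (1 : Heis)

/-- `X` is a geodesic vector: `exp (tX) (p)` is a geodesic. -/
def IsGeodesicVector (F : Heis → Heis → ℝ) (X : LieG) : Prop :=
  ∃ γ : ℝ → Heis, IsOrbitOn γ X Set.univ ∧ IsGeodesicOn F γ Set.univ

/-- `(G / H, F)` is a geodesic orbit space: each geodesic through `p` is of the form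
`exp (tX) (p)` with `X ∈ 𝔤`. -/
def IsGeodesicOrbit (F : Heis → Heis → ℝ) : Prop :=
  ∀ (I : Set ℝ) (γ : ℝ → Heis), IsOpen I → I.OrdConnected → (0 : ℝ) ∈ I →
    IsGeodesicOn F γ I → γ 0 = 1 → ∃ X : LieG, IsOrbitOn γ X I

/-- `(G / H, F)` is naturally reductive: for some reductive decomposition `𝔤 = 𝔥 + 𝔪`, each geodesic
through `p` is of the form `exp (tX) (p)` with `X ∈ 𝔪`. -/
def IsNaturallyReductive (F : Heis → Heis → ℝ) : Prop :=
  ∃ m : Submodule ℝ LieG, IsReductive m ∧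
    ∀ (I : Set ℝ) (γ : ℝ → Heis), IsOpen I → I.OrdConnected → (0 : ℝ) ∈ I →
      IsGeodesicOn F γ I → γ 0 = 1 → ∃ X ∈ m, IsOrbitOn γ X I

/-- `y ↦ ξ(y) D` is a geodesic graph `𝔫 → 𝔥`, for the reductive decomposition `𝔤 = 𝔥 + 𝔫`: an
`Ad(H)`-equivariant map such that `y + ξ(y) D` is a geodesic vector for each `y ≠ 0`. -/
def IsGeodesicGraph (F : Heis → Heis → ℝ) (ξ : Heis → ℝ) : Prop :=
  (∀ (R : SO2) (y : Heis), LieG.mk 0 (ξ (rotFun R y)) = Ad R (LieG.mk 0 (ξ y))) ∧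
    ∀ y : Heis, y ≠ 0 → IsGeodesicVector F (LieG.mk y (ξ y))

/-! Riemannian metrics and `(α₁, α₂)` metrics. -/

/-- The scalar product `g` on `T_p H₃ = 𝔫` determines a `G`-invariant Riemannian metric on `H₃` which
is naturally reductive: for some reductive decomposition `𝔤 = 𝔥 + 𝔪`, one has
`⟨[z, x]_𝔪, y⟩ + ⟨x, [z, y]_𝔪⟩ = 0` on `𝔪`. A vector in `𝔪` is identified with its image in
`𝔤 / 𝔥 = T_p H₃`, so that `[z, x]_𝔪` is identified with the image of `[z, x]`. -/
structure IsNaturallyReductiveRiemannian (g : LinearMap.BilinForm ℝ Heis) : Prop where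
  symm : ∀ x y, g x y = g y x
  pos : ∀ x, x ≠ 0 → 0 < g x x
  invariant : ∀ (R : SO2) (x y : Heis), g (rotFun R x) (rotFun R y) = g x y
  naturallyReductive : ∃ m : Submodule ℝ LieG, IsReductive m ∧
    ∀ x ∈ m, ∀ y ∈ m, ∀ z ∈ m, g (⁅z, x⁆ : LieG).fst y.fst + g x.fst (⁅z, y⁆ : LieG).fst = 0

/-- A subspace of `𝔫` which is `Ad(H)`-invariant. -/
def IsAdInvariant (V : Submodule ℝ Heis) : Prop :=
  ∀ (R : SO2), ∀ x ∈ V, rotFun R x ∈ V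

/-- A subspace of `𝔫` which is `Ad(H)`-irreducible. -/
def IsAdIrreducible (V : Submodule ℝ Heis) : Prop :=
  V ≠ ⊥ ∧ IsAdInvariant V ∧ ∀ W ≤ V, IsAdInvariant W → W = ⊥ ∨ W = V

/-- `α` restricts to an `Ad(H)`-invariant scalar product on the subspace `V` of `𝔫`. -/
structure IsInvariantScalarProductOn (α : LinearMap.BilinForm ℝ Heis) (V : Submodule ℝ Heis) :
    Prop where
  symm : ∀ x ∈ V, ∀ y ∈ V, α x y = α y x
  pos : ∀ x ∈ V, x ≠ 0 → 0 < α x x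
  invariant : ∀ (R : SO2), ∀ x ∈ V, ∀ y ∈ V, α (rotFun R x) (rotFun R y) = α x y

/-- The norm `N` on `𝔫` is of the `(α₁, α₂)`-type: `N(y) = f(α₁(y₁), α₂(y₂))` with respect to a
decomposition `𝔫 = 𝔪₁ ⊕ 𝔪₂` into `Ad(H)`-irreducible subspaces, where `f` is continuous on
`[0, ∞)²` and smooth away from the origin. -/
def IsAlphaType (N : Heis → ℝ) : Prop :=
  ∃ (m₁ m₂ : Submodule ℝ Heis) (α₁ α₂ : LinearMap.BilinForm ℝ Heis) (f : ℝ × ℝ → ℝ),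
    IsCompl m₁ m₂ ∧ IsAdIrreducible m₁ ∧ IsAdIrreducible m₂ ∧
    IsInvariantScalarProductOn α₁ m₁ ∧ IsInvariantScalarProductOn α₂ m₂ ∧
    ContinuousOn f (Set.Ici 0 ×ˢ Set.Ici 0) ∧
    ContDiffOn ℝ ∞ f ((Set.Ici 0 ×ˢ Set.Ici 0) \ {0}) ∧
    ∀ y₁ ∈ m₁, ∀ y₂ ∈ m₂, N (y₁ + y₂) = f (α₁ y₁ y₁, α₂ y₂ y₂)

/-- The scalar product on `𝔫` for which `E₁, E₂, E₃` are orthogonal, `⟨E₁, E₁⟩ = ⟨E₂, E₂⟩ = 1` and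
`⟨E₃, E₃⟩ = c`. -/
def scalarProduct (c : ℝ) : LinearMap.BilinForm ℝ Heis :=
  LinearMap.mk₂ ℝ (fun x y => x 0 * y 0 + x 1 * y 1 + c * (x 2 * y 2))
    (by intros; simp; ring) (by intros; simp; ring) (by intros; simp; ring)
    (by intros; simp; ring)

/-- The norm `√(y₁² + y₂² + c y₃²)` of this scalar product. -/
def normOf (c : ℝ) (y : Heis) : ℝ := √(scalarProduct c y y)

/-- The partial derivative of `L` in the first variable. -/
def partial₁ (L : ℝ × ℝ → ℝ) (q : ℝ × ℝ) : ℝ := fderiv ℝ L q (1, 0)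

/-- The partial derivative of `L` in the second variable. -/
def partial₂ (L : ℝ × ℝ → ℝ) (q : ℝ × ℝ) : ℝ := fderiv ℝ L q (0, 1)

/-- The admissible functions `L` on the quadrant `[0, ∞)²`. -/
structure IsAdmissible (L : ℝ × ℝ → ℝ) : Prop where
  continuousOn : ContinuousOn L (Set.Ici 0 ×ˢ Set.Ici 0)
  smooth : ContDiffOn ℝ ∞ L (Set.Ioi 0 ×ˢ Set.Ioi 0)
  pos : ∀ q ∈ Set.Ioi (0 : ℝ) ×ˢ Set.Ioi (0 : ℝ), 0 < L q
  homogeneous : ∀ q ∈ Set.Ici (0 : ℝ) ×ˢ Set.Ici (0 : ℝ), ∀ r : ℝ, 0 ≤ r → L (r • q) = r ^ 2 * L q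
  partial₁_nonneg : ∀ q ∈ Set.Ioi (0 : ℝ) ×ˢ Set.Ioi (0 : ℝ), 0 ≤ partial₁ L q
  partial₂_nonneg : ∀ q ∈ Set.Ioi (0 : ℝ) ×ˢ Set.Ioi (0 : ℝ), 0 ≤ partial₂ L q
  hessian_nonneg : ∀ q ∈ Set.Ioi (0 : ℝ) ×ˢ Set.Ioi (0 : ℝ), ∀ w : ℝ × ℝ,
    0 ≤ iteratedFDeriv ℝ 2 L q ![w, w]
  partial_sum_pos : ∀ q ∈ Set.Ioi (0 : ℝ) ×ˢ Set.Ioi (0 : ℝ), 0 < partial₁ L q + partial₂ L q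

/-- The norm `F = √(L(√g₁, √g₂))` on `𝔫`, where `gᵢ` is the scalar product with parameter `cᵢ`. -/
def combinedNorm (c₁ c₂ : ℝ) (L : ℝ × ℝ → ℝ) (y : Heis) : ℝ :=
  √(L (normOf c₁ y, normOf c₂ y))

/-- The function `ξ(y) = (C₂(y) / C₁(y)) y₃`, where `C₁ = L,₁ / F₁ + L,₂ / F₂` and
`C₂ = c₁ L,₁ / F₁ + c₂ L,₂ / F₂`. -/
def graphOf (c₁ c₂ : ℝ) (L : ℝ × ℝ → ℝ) (y : Heis) : ℝ :=
  let F₁ := normOf c₁ y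
  let F₂ := normOf c₂ y
  let B₁ := partial₁ L (F₁, F₂) / F₁
  let B₂ := partial₂ L (F₁, F₂) / F₂
  (c₁ * B₁ + c₂ * B₂) / (B₁ + B₂) * y 2

/-- The function `L(a, b) = (a³ + b³)^(2/3)`. -/
def cubicL (q : ℝ × ℝ) : ℝ := (q.1 ^ 3 + q.2 ^ 3) ^ ((2 : ℝ) / 3)

/-- `ξ` is a geodesic graph of `F`, and it is the only continuous one; more precisely, it is
continuous, and any geodesic graph agrees with it where the component of `y` in `span (E₁, E₂)` is
nonzero. -/
def IsUniqueGeodesicGraph (F : Heis → Heis → ℝ) (ξ : Heis → ℝ) : Prop :=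
  Continuous ξ ∧ IsGeodesicGraph F ξ ∧
    ∀ η : Heis → ℝ, IsGeodesicGraph F η → ∀ y : Heis, (y 0 ≠ 0 ∨ y 1 ≠ 0) → η y = ξ y

end HeisFinsler

end

open HeisFinsler

noncomputable section

namespace HeisFinsler

/-! Left translations trivialize the tangent bundle, so the metric is a norm on `𝔫` evaluated at u,
the velocity translated to p. With E = F²/2 = L(F₁, F₂)/2, the two scalar products agree on E₁, E₂
and differ only by the factor cᵢ on E₃. Hence dE = S (y₁ dy₁ + y₂ dy₂) + T y₃ dy₃, where S = (B₁ +
B₂)/2 > 0 and T = (c₁B₁ + c₂B₂)/2 are rotation-invariant (`IsAdmissible.fderiv_energy_apply`). The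
Hessian of E is positive definite (`IsAdmissible.fderiv_fderiv_energy_pos`): transversally by strict
Cauchy–Schwarz for the Fᵢ, radially by Euler's identity for L.

Along exp(tX)(p) with X = y + aD, the translated velocity is y rotated with angular speed a, and the
Euler–Lagrange equations collapse to (S a − T y₃) times a linear form that vanishes only if y₁ = y₂
= 0. So a = (T/S) y₃ always gives a geodesic (`IsAdmissible.isGeodesicVector_graphOf`) and is forced
off the E₃-axis (`IsAdmissible.snd_eq_graphOf`).

For an arbitrary geodesic, the equations read E''(u)(u', ·) = T u₃ (−u₂, u₁, 0). Nondegeneracy of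
E'' makes u' an infinitesimal rotation of u with speed ξ(u) (`IsGeodesicOn.hasDerivAt_leftTriv`).
Then u₁² + u₂² and u₃ are conserved, so ξ(u) is constant and the geodesic is an orbit
(`IsAdmissible.isGeodesicOrbit`).

An `Ad(H)`-invariant complement of `𝔥` must be {y + b y₃ D} for a constant b. Natural reductivity
therefore makes the graph equal to b y₃, first off the axis and then everywhere by continuity
(`IsAdmissible.isLinearMap_graphOf`). For the cubic L, the coefficient of y₃ really varies with y₁²
+ y₂² when c₁ ≠ c₂ (`not_isLinearMap_of_eq_cubic`). -/

/-! ### Calculus in the coordinates of the Heisenberg group. -/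

theorem Heis.hasDerivAt_iff {γ : ℝ → Heis} {v : Heis} {t : ℝ} :
    HasDerivAt γ v t ↔ ∀ i, HasDerivAt (fun s => γ s i) (v i) t :=
  hasDerivAt_pi (φ := fun s i => γ s i) (φ' := v)

theorem Heis.hasFDerivAt_iff {E : Type*} [NormedAddCommGroup E] [NormedSpace ℝ E]
    {f : E → Heis} {f' : E →L[ℝ] Heis} {x : E} :
    HasFDerivAt f f' x ↔
      ∀ i, HasFDerivAt (fun z => f z i)
        ((ContinuousLinearMap.proj (R := ℝ) (φ := fun _ : Fin 3 => ℝ) i).comp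
          (show E →L[ℝ] (Fin 3 → ℝ) from f')) x :=
  hasFDerivAt_pi' (Φ := fun z i => f z i)

theorem Heis.contDiffOn_iff {E : Type*} [NormedAddCommGroup E] [NormedSpace ℝ E]
    {f : E → Heis} {s : Set E} {n : WithTop ℕ∞} :
    ContDiffOn ℝ n f s ↔ ∀ i, ContDiffOn ℝ n (fun z => f z i) s :=
  contDiffOn_pi (Φ := fun z i => f z i)

/-- The coordinates on `𝔫`. -/
def Heis.coord (i : Fin 3) : Heis →L[ℝ] ℝ :=
  ContinuousLinearMap.proj (R := ℝ) (φ := fun _ : Fin 3 => ℝ) i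

@[simp] theorem Heis.coord_apply (i : Fin 3) (x : Heis) : Heis.coord i x = x i := rfl

@[fun_prop] theorem Heis.contDiff_coord (i : Fin 3) {n : WithTop ℕ∞} :
    ContDiff ℝ n fun x : Heis => x i :=
  (Heis.coord i).contDiff

@[fun_prop] theorem Heis.continuous_coord (i : Fin 3) : Continuous fun x : Heis => x i :=
  (Heis.coord i).continuous

theorem Heis.hasFDerivAt_coord (i : Fin 3) (x : Heis) :
    HasFDerivAt (fun x : Heis => x i) (Heis.coord i) x :=
  (Heis.coord i).hasFDerivAt

@[simp] theorem Heis.zero_coord (i : Fin 3) : (0 : Heis) i = 0 := rfl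
@[simp] theorem Heis.sub_coord (x y : Heis) (i : Fin 3) : (x - y) i = x i - y i := rfl

/-- The vector with the given coordinates. -/
def Heis.vec (a b c : ℝ) : Heis := ![a, b, c]

@[simp] theorem Heis.vec_zero (a b c : ℝ) : Heis.vec a b c 0 = a := rfl
@[simp] theorem Heis.vec_one (a b c : ℝ) : Heis.vec a b c 1 = b := rfl
@[simp] theorem Heis.vec_two (a b c : ℝ) : Heis.vec a b c 2 = c := rfl

theorem Heis.ne_zero_iff {y : Heis} : y ≠ 0 ↔ y 0 ≠ 0 ∨ y 1 ≠ 0 ∨ y 2 ≠ 0 := by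
  constructor
  · intro h
    by_contra! hc
    exact h (Heis.ext hc.1 hc.2.1 hc.2.2)
  · rintro h rfl
    simp at h

/-- The linear map `𝔫 → 𝔫` whose three coordinates are the given linear forms. -/
def Heis.linMap (f : Fin 3 → Heis →L[ℝ] ℝ) : Heis →L[ℝ] Heis :=
  ContinuousLinearMap.pi (φ := fun _ : Fin 3 => ℝ) f

@[simp] theorem Heis.linMap_apply (f : Fin 3 → Heis →L[ℝ] ℝ) (x : Heis) (i : Fin 3) :
    Heis.linMap f x i = f i x := rfl

/-! ### Left trivialization and invariance under `G`. -/

/-- The trivialization of the tangent bundle of `H₃` by left translations. -/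
def leftTriv (x : Heis) : Heis →L[ℝ] Heis :=
  Heis.linMap ![Heis.coord 0, Heis.coord 1,
    Heis.coord 2 + (2⁻¹ * x 1) • Heis.coord 0 - (2⁻¹ * x 0) • Heis.coord 1]

@[simp] theorem leftTriv_zero (x v : Heis) : leftTriv x v 0 = v 0 := rfl
@[simp] theorem leftTriv_one (x v : Heis) : leftTriv x v 1 = v 1 := rfl
@[simp] theorem leftTriv_two (x v : Heis) :
    leftTriv x v 2 = v 2 + (x 1 * v 0 - x 0 * v 1) / 2 := by
  have : leftTriv x v 2 = v 2 + (2⁻¹ * x 1) * v 0 - (2⁻¹ * x 0) * v 1 := rfl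
  rw [this]; ring

theorem leftTriv_ne_zero (x : Heis) {v : Heis} (hv : v ≠ 0) : leftTriv x v ≠ 0 := by
  intro h
  have h0 : v 0 = 0 := by rw [← leftTriv_zero x v, h]; rfl
  have h1 : v 1 = 0 := by rw [← leftTriv_one x v, h]; rfl
  have h2 : leftTriv x v 2 = 0 := by rw [h]; rfl
  rw [leftTriv_two, h0, h1] at h2
  exact hv (Heis.ext h0 h1 (by simpa using h2))

theorem fderiv_inv_mul (x v : Heis) :
    fderiv ℝ (fun z : Heis => x⁻¹ * z) x v = leftTriv x v := by
  have h : HasFDerivAt (fun z : Heis => x⁻¹ * z) (leftTriv x) x := by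
    refine Heis.hasFDerivAt_iff.2 fun i => ?_
    have h0 := Heis.hasFDerivAt_coord 0 x
    have h1 := Heis.hasFDerivAt_coord 1 x
    have h2 := Heis.hasFDerivAt_coord 2 x
    fin_cases i
    · exact h0.const_add (-x 0)
    · exact h1.const_add (-x 1)
    · refine ((h2.const_add (-x 2)).add
        (((h1.const_mul (-x 0)).sub (h0.const_mul (-x 1))).mul_const 2⁻¹)).congr_fderiv ?_
      ext v
      change v 2 + 2⁻¹ * (-x 0 * v 1 - -x 1 * v 0) = leftTriv x v 2
      rw [leftTriv_two]
      ring
  rw [h.fderiv]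

theorem invariantMetric_eq (N : Heis → ℝ) (x v : Heis) :
    invariantMetric N x v = N (leftTriv x v) := by
  rw [invariantMetric, fderiv_inv_mul]

/-- Left translations disappear in the left trivialization, and a rotation, being a linear
automorphism, acts by itself. This reduces `G`-invariance of a metric to `Ad(H)`-invariance of its
norm at p. -/
theorem leftTriv_fderiv_smul (g : G) (x v : Heis) :
    leftTriv (g • x) (fderiv ℝ (fun z : Heis => g • z) x v) =
      rotFun g.right (leftTriv x v) := by
  obtain ⟨n, R⟩ := g
  set r0 : Heis →L[ℝ] ℝ := R.1 0 0 • Heis.coord 0 + R.1 0 1 • Heis.coord 1 with hr0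
  set r1 : Heis →L[ℝ] ℝ := R.1 1 0 • Heis.coord 0 + R.1 1 1 • Heis.coord 1 with hr1
  have h : HasFDerivAt (fun z : Heis => (⟨n, R⟩ : G) • z)
      (Heis.linMap ![r0, r1,
        Heis.coord 2 + (2⁻¹ : ℝ) • (n 0 • r1 - n 1 • r0)]) x := by
    refine Heis.hasFDerivAt_iff.2 fun i => ?_
    have h0 := Heis.hasFDerivAt_coord 0 x
    have h1 := Heis.hasFDerivAt_coord 1 x
    have h2 := Heis.hasFDerivAt_coord 2 x
    have hR0 := (h0.const_mul (R.1 0 0)).add (h1.const_mul (R.1 0 1))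
    have hR1 := (h0.const_mul (R.1 1 0)).add (h1.const_mul (R.1 1 1))
    fin_cases i
    · exact hR0.const_add (n 0)
    · exact hR1.const_add (n 1)
    · exact (h2.const_add (n 2)).add
        (((hR1.const_mul (n 0)).sub (hR0.const_mul (n 1))).mul_const 2⁻¹)
  rw [h.fderiv]
  have e0 : r0 v = R.1 0 0 * v 0 + R.1 0 1 * v 1 := rfl
  have e1 : r1 v = R.1 1 0 * v 0 + R.1 1 1 * v 1 := rfl
  have f0 : ((⟨n, R⟩ : G) • x) 0 = n 0 + (R.1 0 0 * x 0 + R.1 0 1 * x 1) := rfl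
  have f1 : ((⟨n, R⟩ : G) • x) 1 = n 1 + (R.1 1 0 * x 0 + R.1 1 1 * x 1) := rfl
  ext
  · simp [e0]
  · simp [e1]
  · simp only [leftTriv_two, Heis.linMap_apply, rotFun_two, f0, f1, Matrix.cons_val, e0, e1,
      add_apply, smul_apply, sub_apply,
      Heis.coord_apply, smul_eq_mul]
    -- The bracket term is an area form on the plane, which R multiplies by det R = 1.
    linear_combination ((x 1 * v 0 - x 0 * v 1) / 2) * R.det_eq

theorem contDiff_leftTriv {n : WithTop ℕ∞} :
    ContDiff ℝ n fun q : Heis × Heis => leftTriv q.1 q.2 := by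
  rw [← contDiffOn_univ]
  refine Heis.contDiffOn_iff.2 fun i => ContDiff.contDiffOn ?_
  have hf : ∀ j, ContDiff ℝ n fun q : Heis × Heis => q.1 j := fun j =>
    (Heis.contDiff_coord j).comp contDiff_fst
  have hs : ∀ j, ContDiff ℝ n fun q : Heis × Heis => q.2 j := fun j =>
    (Heis.contDiff_coord j).comp contDiff_snd
  fin_cases i
  · exact hs 0
  · exact hs 1
  · simp only [Fin.reduceFinMk, leftTriv_two]
    exact (hs 2).add ((((hf 1).mul (hs 0)).sub ((hf 0).mul (hs 1))).div_const 2)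

theorem rotFun_ne_zero (R : SO2) {y : Heis} (hy : y ≠ 0) : rotFun R y ≠ 0 := by
  intro h
  apply hy
  have : rotFun R⁻¹ (rotFun R y) = y := by rw [← rotFun_mul, inv_mul_cancel, rotFun_one_left]
  rw [← this, h]
  ext <;> simp

theorem SO2.sq_add_sq (R : SO2) (a b : ℝ) :
    (R.1 0 0 * a + R.1 0 1 * b) ^ 2 + (R.1 1 0 * a + R.1 1 1 * b) ^ 2 = a ^ 2 + b ^ 2 := by
  obtain ⟨h1, h2, h3⟩ := Matrix.mem_specialOrthogonalGroup_fin_two_iff.1 R.2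
  rw [h1, h2] at *
  nlinarith [h3]

/-! ### The scalar products on `𝔫` and their norms. -/

theorem scalarProduct_apply (c : ℝ) (x y : Heis) :
    scalarProduct c x y = x 0 * y 0 + x 1 * y 1 + c * (x 2 * y 2) := rfl

theorem scalarProduct_self_pos {c : ℝ} (hc : 0 < c) {y : Heis} (hy : y ≠ 0) :
    0 < scalarProduct c y y := by
  rw [scalarProduct_apply]
  rcases Heis.ne_zero_iff.1 hy with h | h | h
  · have := mul_self_pos.2 h
    nlinarith [mul_self_nonneg (y 1), mul_nonneg hc.le (mul_self_nonneg (y 2))]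
  · have := mul_self_pos.2 h
    nlinarith [mul_self_nonneg (y 0), mul_nonneg hc.le (mul_self_nonneg (y 2))]
  · have := mul_pos hc (mul_self_pos.2 h)
    nlinarith [mul_self_nonneg (y 0), mul_self_nonneg (y 1)]

theorem scalarProduct_rotFun (c : ℝ) (R : SO2) (x y : Heis) :
    scalarProduct c (rotFun R x) (rotFun R y) = scalarProduct c x y := by
  obtain ⟨h1, h2, h3⟩ := Matrix.mem_specialOrthogonalGroup_fin_two_iff.1 R.2
  simp only [scalarProduct_apply, rotFun_zero, rotFun_one, rotFun_two, h1, h2] at h3 ⊢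
  linear_combination (x 0 * y 0 + x 1 * y 1) * h3

theorem normOf_nonneg (c : ℝ) (y : Heis) : 0 ≤ normOf c y := Real.sqrt_nonneg _

theorem normOf_pos {c : ℝ} (hc : 0 < c) {y : Heis} (hy : y ≠ 0) : 0 < normOf c y :=
  Real.sqrt_pos.2 (scalarProduct_self_pos hc hy)

theorem normOf_sq {c : ℝ} (hc : 0 < c) (y : Heis) : normOf c y ^ 2 = scalarProduct c y y := by
  refine Real.sq_sqrt ?_
  rcases eq_or_ne y 0 with rfl | hy
  · simp
  · exact (scalarProduct_self_pos hc hy).le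

@[simp] theorem normOf_zero (c : ℝ) : normOf c 0 = 0 := by
  simp [normOf]

theorem normOf_smul (c : ℝ) (r : ℝ) (hr : 0 ≤ r) (y : Heis) :
    normOf c (r • y) = r * normOf c y := by
  have h : scalarProduct c (r • y) (r • y) = r * r * scalarProduct c y y := by
    simp only [scalarProduct_apply, heis_smul_apply]
    ring
  rw [normOf, normOf, h, Real.sqrt_mul (mul_self_nonneg r), Real.sqrt_mul_self hr]

theorem normOf_rotFun (c : ℝ) (R : SO2) (y : Heis) : normOf c (rotFun R y) = normOf c y := by
  rw [normOf, normOf, scalarProduct_rotFun]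

theorem continuous_normOf (c : ℝ) : Continuous (normOf c) := by
  unfold normOf
  simp only [scalarProduct_apply]
  fun_prop

/-- The linear form `w ↦ ⟨y, w⟩` of the scalar product with parameter `c`. -/
def pairing (c : ℝ) (y : Heis) : Heis →L[ℝ] ℝ :=
  y 0 • Heis.coord 0 + y 1 • Heis.coord 1 + (c * y 2) • Heis.coord 2

theorem pairing_apply (c : ℝ) (y w : Heis) :
    pairing c y w = y 0 * w 0 + y 1 * w 1 + c * y 2 * w 2 := rfl

theorem hasFDerivAt_normOf {c : ℝ} (hc : 0 < c) {y : Heis} (hy : y ≠ 0) :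
    HasFDerivAt (normOf c) ((normOf c y)⁻¹ • pairing c y) y := by
  have h0 := Heis.hasFDerivAt_coord 0 y
  have h1 := Heis.hasFDerivAt_coord 1 y
  have h2 := Heis.hasFDerivAt_coord 2 y
  have h := (((h0.mul h0).add (h1.mul h1)).add ((h2.mul h2).const_mul c)).sqrt
    (scalarProduct_self_pos hc hy).ne'
  refine h.congr_fderiv ?_
  ext w
  change 1 / (2 * normOf c y) * ((y 0 * w 0 + y 0 * w 0) + (y 1 * w 1 + y 1 * w 1) +
    c * (y 2 * w 2 + y 2 * w 2)) = (normOf c y)⁻¹ * pairing c y w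
  rw [pairing_apply]
  have := (normOf_pos hc hy).ne'
  field_simp
  ring

theorem contDiffAt_normOf {c : ℝ} (hc : 0 < c) {y : Heis} (hy : y ≠ 0) {n : WithTop ℕ∞} :
    ContDiffAt ℝ n (normOf c) y := by
  have h : ContDiffAt ℝ n (fun y : Heis => y 0 * y 0 + y 1 * y 1 + c * (y 2 * y 2)) y :=
    ContDiff.contDiffAt (by fun_prop)
  exact h.sqrt (scalarProduct_self_pos hc hy).ne'

/-- Strict Cauchy–Schwarz: subtracting from w its projection k v leaves a nonzero vector, whose
squared length is positive. -/
theorem scalarProduct_sq_lt {c : ℝ} (hc : 0 < c) {v w : Heis} (hv : v ≠ 0)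
    (hw : ∀ r : ℝ, w ≠ r • v) :
    scalarProduct c v w ^ 2 < scalarProduct c v v * scalarProduct c w w := by
  have hpos := scalarProduct_self_pos hc hv
  set k := scalarProduct c v w / scalarProduct c v v with hk
  have h := scalarProduct_self_pos hc (sub_ne_zero.2 (hw k))
  have hkv : k * scalarProduct c v v = scalarProduct c v w := div_mul_cancel₀ _ hpos.ne'
  have e : scalarProduct c (w - k • v) (w - k • v) =
      scalarProduct c w w - 2 * k * scalarProduct c v w + k ^ 2 * scalarProduct c v v := by
    simp only [scalarProduct_apply, Heis.sub_coord, heis_smul_apply]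
    ring
  rw [e] at h
  nlinarith [mul_pos hpos h]

theorem isOpen_quadrant : IsOpen (Set.Ioi (0 : ℝ) ×ˢ Set.Ioi (0 : ℝ)) :=
  isOpen_Ioi.prod isOpen_Ioi

/-! ### Admissible functions and Euler's identities. -/

section Admissible
variable {c₁ c₂ : ℝ} {L : ℝ × ℝ → ℝ} {q : ℝ × ℝ}

theorem IsAdmissible.contDiffAt (hL : IsAdmissible L)
    (hq : q ∈ Set.Ioi (0 : ℝ) ×ˢ Set.Ioi (0 : ℝ)) : ContDiffAt ℝ ∞ L q :=
  hL.smooth.contDiffAt (isOpen_quadrant.mem_nhds hq)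

theorem IsAdmissible.hasFDerivAt (hL : IsAdmissible L)
    (hq : q ∈ Set.Ioi (0 : ℝ) ×ˢ Set.Ioi (0 : ℝ)) : HasFDerivAt L (fderiv ℝ L q) q :=
  ((hL.contDiffAt hq).differentiableAt (by simp)).hasFDerivAt

theorem IsAdmissible.hasFDerivAt_fderiv (hL : IsAdmissible L)
    (hq : q ∈ Set.Ioi (0 : ℝ) ×ˢ Set.Ioi (0 : ℝ)) :
    HasFDerivAt (fderiv ℝ L) (fderiv ℝ (fderiv ℝ L) q) q :=
  (((hL.contDiffAt hq).fderiv_right (m := ∞) (by simp)).differentiableAt (by simp)).hasFDerivAt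

theorem fderiv_apply_eq_partial (L : ℝ × ℝ → ℝ) (q : ℝ × ℝ) (a b : ℝ) :
    fderiv ℝ L q (a, b) = partial₁ L q * a + partial₂ L q * b := by
  have : ((a, b) : ℝ × ℝ) = a • ((1, 0) : ℝ × ℝ) + b • ((0, 1) : ℝ × ℝ) := by simp
  rw [this, map_add, map_smul, map_smul, partial₁, partial₂, smul_eq_mul, smul_eq_mul]
  ring

theorem IsAdmissible.map_zero (hL : IsAdmissible L) : L 0 = 0 := by
  simpa using hL.homogeneous 0 ⟨Set.mem_Ici.2 le_rfl, Set.mem_Ici.2 le_rfl⟩ 0 le_rfl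

/-- Euler's identity for the first derivative, along the ray through `q`. -/
theorem IsAdmissible.fderiv_ray (hL : IsAdmissible L)
    (hq : q ∈ Set.Ioi (0 : ℝ) ×ˢ Set.Ioi (0 : ℝ)) {r : ℝ} (hr : 0 < r) :
    fderiv ℝ L (r • q) q = 2 * r * L q := by
  have hrq : r • q ∈ Set.Ioi (0 : ℝ) ×ˢ Set.Ioi (0 : ℝ) :=
    ⟨mul_pos hr hq.1, mul_pos hr hq.2⟩
  have h1 : HasDerivAt (fun s : ℝ => L (s • q)) (fderiv ℝ L (r • q) ((1 : ℝ) • q)) r :=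
    (hL.hasFDerivAt hrq).comp_hasDerivAt r ((hasDerivAt_id r).smul_const q)
  have h2 : HasDerivAt (fun s : ℝ => L (s • q)) (2 * r * L q) r := by
    have h3 : HasDerivAt (fun s : ℝ => s ^ 2 * L q) (2 * r * L q) r := by
      simpa using (hasDerivAt_pow 2 r).mul_const (L q)
    refine h3.congr_of_eventuallyEq ?_
    filter_upwards [lt_mem_nhds hr] with s hs
    exact hL.homogeneous q ⟨(Set.mem_Ioi.1 hq.1).le, (Set.mem_Ioi.1 hq.2).le⟩ s hs.le
  rw [one_smul] at h1
  exact h1.unique h2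

/-- Euler's identity for the second derivative. -/
theorem IsAdmissible.fderiv_fderiv_self (hL : IsAdmissible L)
    (hq : q ∈ Set.Ioi (0 : ℝ) ×ˢ Set.Ioi (0 : ℝ)) :
    fderiv ℝ (fderiv ℝ L) q q q = 2 * L q := by
  have h1 : HasDerivAt (fun s : ℝ => fderiv ℝ L (s • q))
      (fderiv ℝ (fderiv ℝ L) ((1 : ℝ) • q) ((1 : ℝ) • q)) 1 :=
    HasFDerivAt.comp_hasDerivAt (1 : ℝ) (hL.hasFDerivAt_fderiv (by simpa using hq))
      ((hasDerivAt_id (1 : ℝ)).smul_const q)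
  have h2 := h1.clm_apply (hasDerivAt_const (1 : ℝ) q)
  have h3 : HasDerivAt (fun s : ℝ => fderiv ℝ L (s • q) q) (2 * L q) 1 := by
    have h4 : HasDerivAt (fun s : ℝ => 2 * s * L q) (2 * L q) 1 := by
      simpa using ((hasDerivAt_id (1 : ℝ)).const_mul 2).mul_const (L q)
    refine h4.congr_of_eventuallyEq ?_
    filter_upwards [lt_mem_nhds one_pos] with s hs
    exact hL.fderiv_ray hq hs
  simpa using h2.unique h3

theorem IsAdmissible.fderiv_fderiv_nonneg (hL : IsAdmissible L)
    (hq : q ∈ Set.Ioi (0 : ℝ) ×ˢ Set.Ioi (0 : ℝ)) (w : ℝ × ℝ) :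
    0 ≤ fderiv ℝ (fderiv ℝ L) q w w := by
  simpa [iteratedFDeriv_two_apply] using hL.hessian_nonneg q hq w

/-- The pair of norms `(F₁, F₂)`. -/
def normPair (c₁ c₂ : ℝ) (y : Heis) : ℝ × ℝ := (normOf c₁ y, normOf c₂ y)

theorem normPair_mem (h₁ : 0 < c₁) (h₂ : 0 < c₂) {y : Heis} (hy : y ≠ 0) :
    normPair c₁ c₂ y ∈ Set.Ioi (0 : ℝ) ×ˢ Set.Ioi (0 : ℝ) :=
  ⟨normOf_pos h₁ hy, normOf_pos h₂ hy⟩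

theorem contDiffAt_normPair (h₁ : 0 < c₁) (h₂ : 0 < c₂) {y : Heis} (hy : y ≠ 0)
    {n : WithTop ℕ∞} : ContDiffAt ℝ n (normPair c₁ c₂) y :=
  (contDiffAt_normOf h₁ hy).prodMk (contDiffAt_normOf h₂ hy)

theorem hasFDerivAt_normPair (h₁ : 0 < c₁) (h₂ : 0 < c₂) {y : Heis} (hy : y ≠ 0) :
    HasFDerivAt (normPair c₁ c₂)
      (((normOf c₁ y)⁻¹ • pairing c₁ y).prod ((normOf c₂ y)⁻¹ • pairing c₂ y)) y :=
  (hasFDerivAt_normOf h₁ hy).prodMk (hasFDerivAt_normOf h₂ hy)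

/-! ### The energy and its differential. -/

/-- The energy `F² / 2` on `𝔫`. -/
def energy (c₁ c₂ : ℝ) (L : ℝ × ℝ → ℝ) (y : Heis) : ℝ := combinedNorm c₁ c₂ L y ^ 2 / 2

/-- The coefficient of `y₁` and `y₂` in the differential of the energy. -/
def horizontalCoeff (c₁ c₂ : ℝ) (L : ℝ × ℝ → ℝ) (y : Heis) : ℝ :=
  (partial₁ L (normPair c₁ c₂ y) / normOf c₁ y + partial₂ L (normPair c₁ c₂ y) / normOf c₂ y) / 2

/-- The coefficient of `y₃` in the differential of the energy. -/
def verticalCoeff (c₁ c₂ : ℝ) (L : ℝ × ℝ → ℝ) (y : Heis) : ℝ :=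
  (c₁ * (partial₁ L (normPair c₁ c₂ y) / normOf c₁ y) +
    c₂ * (partial₂ L (normPair c₁ c₂ y) / normOf c₂ y)) / 2

theorem IsAdmissible.energy_eq (hL : IsAdmissible L) (h₁ : 0 < c₁) (h₂ : 0 < c₂) :
    energy c₁ c₂ L = fun y => L (normPair c₁ c₂ y) / 2 := by
  funext y
  have : 0 ≤ L (normPair c₁ c₂ y) := by
    rcases eq_or_ne y 0 with rfl | hy
    · have : normPair c₁ c₂ 0 = 0 := by simp [normPair]
      rw [this, hL.map_zero]
    · exact (hL.pos _ (normPair_mem h₁ h₂ hy)).le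
  exact congrArg (· / 2) (Real.sq_sqrt this)

theorem graphOf_eq (c₁ c₂ : ℝ) (L : ℝ × ℝ → ℝ) (y : Heis) :
    graphOf c₁ c₂ L y = verticalCoeff c₁ c₂ L y / horizontalCoeff c₁ c₂ L y * y 2 := by
  rw [verticalCoeff, horizontalCoeff, div_div_div_cancel_right₀ two_ne_zero]
  rfl

/-- Nonnegativity of both partial derivatives alone would allow zero; positivity of their sum makes
one of them positive. The geodesic graph divides by this coefficient. -/
theorem IsAdmissible.horizontalCoeff_pos (hL : IsAdmissible L) (h₁ : 0 < c₁) (h₂ : 0 < c₂)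
    {y : Heis} (hy : y ≠ 0) : 0 < horizontalCoeff c₁ c₂ L y := by
  have hq := normPair_mem h₁ h₂ hy
  have p₁ := normOf_pos h₁ hy
  have p₂ := normOf_pos h₂ hy
  refine div_pos ?_ two_pos
  have n₁ := hL.partial₁_nonneg _ hq
  have n₂ := hL.partial₂_nonneg _ hq
  rcases n₁.eq_or_lt with h | h
  · have := hL.partial_sum_pos _ hq
    rw [← h, zero_add] at this
    exact add_pos_of_nonneg_of_pos (div_nonneg n₁ p₁.le) (div_pos this p₂)
  · exact add_pos_of_pos_of_nonneg (div_pos h p₁) (div_nonneg n₂ p₂.le)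

/-- Chain rule with dFᵢ = ⟨y, ·⟩ᵢ / Fᵢ: the two pairings have the same E₁, E₂ parts, so their
weights add up there, while on E₃ each weight carries its own cᵢ. -/
theorem IsAdmissible.hasFDerivAt_energy (hL : IsAdmissible L) (h₁ : 0 < c₁) (h₂ : 0 < c₂)
    {y : Heis} (hy : y ≠ 0) :
    HasFDerivAt (energy c₁ c₂ L) (horizontalCoeff c₁ c₂ L y • (y 0 • Heis.coord 0 +
      y 1 • Heis.coord 1) + (verticalCoeff c₁ c₂ L y * y 2) • Heis.coord 2) y := by
  rw [hL.energy_eq h₁ h₂]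
  have h := ((hL.hasFDerivAt (normPair_mem h₁ h₂ hy)).comp y
    (hasFDerivAt_normPair h₁ h₂ hy)).mul_const 2⁻¹
  refine h.congr_fderiv ?_
  ext w
  change 2⁻¹ * fderiv ℝ L (normPair c₁ c₂ y) ((normOf c₁ y)⁻¹ * pairing c₁ y w,
    (normOf c₂ y)⁻¹ * pairing c₂ y w) = horizontalCoeff c₁ c₂ L y * (y 0 * w 0 + y 1 * w 1) +
    (verticalCoeff c₁ c₂ L y * y 2) * w 2
  rw [fderiv_apply_eq_partial, horizontalCoeff, verticalCoeff, pairing_apply, pairing_apply]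
  ring

theorem IsAdmissible.fderiv_energy_apply (hL : IsAdmissible L) (h₁ : 0 < c₁) (h₂ : 0 < c₂)
    {y : Heis} (hy : y ≠ 0) (w : Heis) :
    fderiv ℝ (energy c₁ c₂ L) y w = horizontalCoeff c₁ c₂ L y * (y 0 * w 0 + y 1 * w 1) +
      verticalCoeff c₁ c₂ L y * y 2 * w 2 := by
  rw [(hL.hasFDerivAt_energy h₁ h₂ hy).fderiv]
  rfl

theorem IsAdmissible.contDiffAt_energy (hL : IsAdmissible L) (h₁ : 0 < c₁) (h₂ : 0 < c₂)
    {y : Heis} (hy : y ≠ 0) : ContDiffAt ℝ ∞ (energy c₁ c₂ L) y := by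
  rw [hL.energy_eq h₁ h₂]
  exact ((hL.contDiffAt (normPair_mem h₁ h₂ hy)).comp y (contDiffAt_normPair h₁ h₂ hy)).div_const 2

theorem IsAdmissible.hasFDerivAt_fderiv_energy (hL : IsAdmissible L) (h₁ : 0 < c₁) (h₂ : 0 < c₂)
    {y : Heis} (hy : y ≠ 0) :
    HasFDerivAt (fderiv ℝ (energy c₁ c₂ L)) (fderiv ℝ (fderiv ℝ (energy c₁ c₂ L)) y) y :=
  (((hL.contDiffAt_energy h₁ h₂ hy).fderiv_right (m := ∞) (by simp)).differentiableAt
    (by simp)).hasFDerivAt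

/-! ### Strong convexity of the energy and the Finsler property. -/

/-- The second derivative of a Euclidean norm along a line. -/
theorem hasDerivAt_normOf_slope {c : ℝ} (hc : 0 < c) {v : Heis} (hv : v ≠ 0) (w : Heis) :
    HasDerivAt (fun t : ℝ => (normOf c (v + t • w))⁻¹ * pairing c (v + t • w) w)
      ((scalarProduct c v v * scalarProduct c w w - scalarProduct c v w ^ 2) / normOf c v ^ 3)
      0 := by
  have hline : HasDerivAt (fun t : ℝ => v + t • w) w 0 := by
    simpa using ((hasDerivAt_id (0 : ℝ)).smul_const w).const_add v
  have hv' : v + (0 : ℝ) • w = v := by simp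
  have hn : HasDerivAt (fun t : ℝ => normOf c (v + t • w))
      ((normOf c v)⁻¹ * pairing c v w) 0 := by
    have := HasFDerivAt.comp_hasDerivAt (0 : ℝ)
      (f := fun t : ℝ => v + t • w) (by rw [hv']; exact hasFDerivAt_normOf hc hv) hline
    exact this
  have hp : HasDerivAt (fun t : ℝ => pairing c (v + t • w) w) (scalarProduct c w w) 0 := by
    have e : (fun t : ℝ => pairing c (v + t • w) w) =
        fun t => scalarProduct c v w + t * scalarProduct c w w := by
      funext t
      simp only [pairing_apply, scalarProduct_apply, heis_add_apply, heis_smul_apply]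
      ring
    rw [e]
    simpa using ((hasDerivAt_id (0 : ℝ)).mul_const (scalarProduct c w w)).const_add
      (scalarProduct c v w)
  have hpos := normOf_pos hc hv
  have h := (hn.inv (by rw [hv']; exact hpos.ne')).mul hp
  refine h.congr_deriv ?_
  have e : pairing c v w = scalarProduct c v w := by
    rw [pairing_apply, scalarProduct_apply]; ring
  simp only [Pi.inv_apply, hv', e, ← normOf_sq hc v]
  field_simp
  ring

/-- The second derivative along v + t w is half of L''(F', F') + L,₁D₁ + L,₂D₂, where Dᵢ = Fᵢ'' is a
Cauchy–Schwarz defect over Fᵢ³. If w is not a multiple of v, both Dᵢ are positive and the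
first-order terms suffice. If w = r v, they vanish, but F' = r (F₁, F₂) and Euler's identity gives
r² L > 0. Thus semidefiniteness of L'' is enough. -/
theorem IsAdmissible.fderiv_fderiv_energy_pos (hL : IsAdmissible L) (h₁ : 0 < c₁) (h₂ : 0 < c₂)
    {v w : Heis} (hv : v ≠ 0) (hw : w ≠ 0) :
    0 < fderiv ℝ (fderiv ℝ (energy c₁ c₂ L)) v w w := by
  have hline : HasDerivAt (fun t : ℝ => v + t • w) w 0 := by
    simpa using ((hasDerivAt_id (0 : ℝ)).smul_const w).const_add v
  have hv' : v + (0 : ℝ) • w = v := by simp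
  have hq := normPair_mem h₁ h₂ hv
  set q := normPair c₁ c₂ v with hqdef
  set F' : ℝ × ℝ := ((normOf c₁ v)⁻¹ * pairing c₁ v w, (normOf c₂ v)⁻¹ * pairing c₂ v w)
  set D₁ := (scalarProduct c₁ v v * scalarProduct c₁ w w - scalarProduct c₁ v w ^ 2) /
    normOf c₁ v ^ 3 with hD₁
  set D₂ := (scalarProduct c₂ v v * scalarProduct c₂ w w - scalarProduct c₂ v w ^ 2) /
    normOf c₂ v ^ 3 with hD₂
  have hE : HasDerivAt (fun t : ℝ => fderiv ℝ (energy c₁ c₂ L) (v + t • w) w)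
      (fderiv ℝ (fderiv ℝ (energy c₁ c₂ L)) v w w) 0 := by
    have h := HasFDerivAt.comp_hasDerivAt (0 : ℝ) (f := fun t : ℝ => v + t • w)
      (by rw [hv']; exact hL.hasFDerivAt_fderiv_energy h₁ h₂ hv) hline
    simpa using h.clm_apply (hasDerivAt_const (0 : ℝ) w)
  have hslope : HasDerivAt (fun t : ℝ =>
      (((normOf c₁ (v + t • w))⁻¹ * pairing c₁ (v + t • w) w,
        (normOf c₂ (v + t • w))⁻¹ * pairing c₂ (v + t • w) w) : ℝ × ℝ)) (D₁, D₂) 0 :=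
    (hasDerivAt_normOf_slope h₁ hv w).prodMk (hasDerivAt_normOf_slope h₂ hv w)
  have hpair : HasDerivAt (fun t : ℝ => normPair c₁ c₂ (v + t • w)) F' 0 := by
    have h := HasFDerivAt.comp_hasDerivAt (0 : ℝ) (f := fun t : ℝ => v + t • w)
      (by rw [hv']; exact hasFDerivAt_normPair h₁ h₂ hv) hline
    exact h
  have hdL : HasDerivAt (fun t : ℝ => fderiv ℝ L (normPair c₁ c₂ (v + t • w)))
      (fderiv ℝ (fderiv ℝ L) q F') 0 :=
    HasFDerivAt.comp_hasDerivAt (0 : ℝ) (f := fun t : ℝ => normPair c₁ c₂ (v + t • w))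
      (by rw [hv']; exact hL.hasFDerivAt_fderiv hq) hpair
  have hE' := (hdL.clm_apply hslope).const_mul 2⁻¹
  have key : fderiv ℝ (fderiv ℝ (energy c₁ c₂ L)) v w w =
      2⁻¹ * (fderiv ℝ (fderiv ℝ L) q F' F' + fderiv ℝ L q (D₁, D₂)) := by
    refine hE.unique ?_
    simp only [hv'] at hE'
    refine hE'.congr_of_eventuallyEq ?_
    have hne : ∀ᶠ t : ℝ in nhds 0, v + t • w ≠ 0 :=
      hline.continuousAt.eventually_ne (by rwa [hv'])
    filter_upwards [hne] with t ht
    rw [hL.fderiv_energy_apply h₁ h₂ ht, fderiv_apply_eq_partial, pairing_apply, pairing_apply,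
      horizontalCoeff, verticalCoeff]
    ring
  rw [key, fderiv_apply_eq_partial]
  have hH := hL.fderiv_fderiv_nonneg hq F'
  have n₁ := hL.partial₁_nonneg _ hq
  have n₂ := hL.partial₂_nonneg _ hq
  have p₁ := normOf_pos h₁ hv
  have p₂ := normOf_pos h₂ hv
  by_cases hpar : ∃ r : ℝ, w = r • v
  · obtain ⟨r, rfl⟩ := hpar
    have hr : r ≠ 0 := by rintro rfl; simp at hw
    have hF : F' = r • q := by
      have e : ∀ c : ℝ, 0 < c → (normOf c v)⁻¹ * pairing c v (r • v) = r * normOf c v := by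
        intro c hc
        have e1 : pairing c v (r • v) = r * normOf c v ^ 2 := by
          rw [normOf_sq hc, pairing_apply, scalarProduct_apply]
          simp only [heis_smul_apply]
          ring
        rw [e1]
        have := (normOf_pos hc hv).ne'
        field_simp
      exact Prod.ext (e c₁ h₁) (e c₂ h₂)
    have hD : ∀ c : ℝ, scalarProduct c v v * scalarProduct c (r • v) (r • v) -
        scalarProduct c v (r • v) ^ 2 = 0 := by
      intro c
      simp only [map_smul, LinearMap.smul_apply, smul_eq_mul]
      ring
    have e₁ : D₁ = 0 := by rw [hD₁, hD, zero_div]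
    have e₂ : D₂ = 0 := by rw [hD₂, hD, zero_div]
    rw [hF, e₁, e₂]
    simp only [map_smul, smul_apply, hL.fderiv_fderiv_self hq, smul_eq_mul]
    have := hL.pos q hq
    have := mul_self_pos.2 hr
    nlinarith [mul_pos this (hL.pos q hq)]
  · push Not at hpar
    have d₁ : 0 < D₁ := div_pos (sub_pos.2 (scalarProduct_sq_lt h₁ hv hpar)) (by positivity)
    have d₂ : 0 < D₂ := div_pos (sub_pos.2 (scalarProduct_sq_lt h₂ hv hpar)) (by positivity)
    have hsum : 0 < partial₁ L q * D₁ + partial₂ L q * D₂ := by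
      rcases n₁.eq_or_lt with h | h
      · have := hL.partial_sum_pos _ hq
        rw [← h, zero_add] at this
        exact add_pos_of_nonneg_of_pos (mul_nonneg n₁ d₁.le) (mul_pos this d₂)
      · exact add_pos_of_pos_of_nonneg (mul_pos h d₁) (mul_nonneg n₂ d₂.le)
    linarith

theorem IsAdmissible.combinedNorm_contDiffAt (hL : IsAdmissible L) (h₁ : 0 < c₁) (h₂ : 0 < c₂)
    {y : Heis} (hy : y ≠ 0) : ContDiffAt ℝ ∞ (combinedNorm c₁ c₂ L) y := by
  have hq := normPair_mem h₁ h₂ hy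
  exact ((hL.contDiffAt hq).comp y (contDiffAt_normPair h₁ h₂ hy)).sqrt (hL.pos _ hq).ne'

theorem combinedNorm_rotFun (c₁ c₂ : ℝ) (L : ℝ × ℝ → ℝ) (R : SO2) (y : Heis) :
    combinedNorm c₁ c₂ L (rotFun R y) = combinedNorm c₁ c₂ L y := by
  simp only [combinedNorm, normOf_rotFun]

theorem IsAdmissible.isHomogeneousFinsler (hL : IsAdmissible L) (h₁ : 0 < c₁) (h₂ : 0 < c₂) :
    IsHomogeneousFinsler (invariantMetric (combinedNorm c₁ c₂ L)) where
  smooth := by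
    intro q hq
    simp only [invariantMetric_eq]
    have h := hL.combinedNorm_contDiffAt h₁ h₂ (leftTriv_ne_zero q.1 hq)
    exact (ContDiffAt.comp q (f := fun q : Heis × Heis => leftTriv q.1 q.2) h
      contDiff_leftTriv.contDiffAt).contDiffWithinAt
  pos x v hv := by
    rw [invariantMetric_eq]
    exact Real.sqrt_pos.2 (hL.pos _ (normPair_mem h₁ h₂ (leftTriv_ne_zero x hv)))
  homogeneous x v r hr := by
    rw [invariantMetric_eq, invariantMetric_eq, map_smul, combinedNorm, normOf_smul _ _ hr,
      normOf_smul _ _ hr]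
    have := hL.homogeneous (normOf c₁ (leftTriv x v), normOf c₂ (leftTriv x v))
      ⟨normOf_nonneg _ _, normOf_nonneg _ _⟩ r hr
    rw [Prod.smul_mk, smul_eq_mul, smul_eq_mul] at this
    rw [this, Real.sqrt_mul (sq_nonneg r), Real.sqrt_sq hr]
    rfl
  fundamental_pos x v hv w hw := by
    have hu := leftTriv_ne_zero x hv
    have hE : (fun u => invariantMetric (combinedNorm c₁ c₂ L) x u ^ 2 / 2) =
        fun u => energy c₁ c₂ L (leftTriv x u) := by
      funext u
      rw [invariantMetric_eq]
      rfl
    rw [hE, iteratedFDeriv_two_apply]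
    simp only [Matrix.cons_val_zero, Matrix.cons_val_one]
    -- E is only known to be differentiable off the origin, so the first derivative is identified
    -- near v, which is all the second derivative sees.
    have hd : ∀ᶠ u in nhds v, fderiv ℝ (fun u => energy c₁ c₂ L (leftTriv x u)) u =
        (fderiv ℝ (energy c₁ c₂ L) (leftTriv x u)).comp (leftTriv x) := by
      filter_upwards [isOpen_ne.mem_nhds hv] with u hu'
      exact ((hL.contDiffAt_energy h₁ h₂ (leftTriv_ne_zero x hu')).differentiableAt
        (by simp)).hasFDerivAt.comp u (leftTriv x).hasFDerivAt |>.fderiv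
    rw [Filter.EventuallyEq.fderiv_eq hd]
    have h := ((hL.hasFDerivAt_fderiv_energy h₁ h₂ hu).comp v
      (leftTriv x).hasFDerivAt).clm_comp (hasFDerivAt_const (leftTriv x) v)
    have h' := h.fderiv
    simp only [Function.comp_apply] at h'
    rw [h']
    simpa using hL.fderiv_fderiv_energy_pos h₁ h₂ hu (leftTriv_ne_zero x hw)
  invariant g x v := by
    rw [invariantMetric_eq, invariantMetric_eq, leftTriv_fderiv_smul, combinedNorm_rotFun]

end Admissible

/-! ### One-parameter subgroups of `G` and the velocity of their orbits. -/

/-- For a homomorphism φ(t + s) = φ(t) φ(s), this reduces the derivative at any t to the given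
velocity at 0. -/
theorem hasDerivAt_of_shift {E : Type*} [NormedAddCommGroup E] [NormedSpace ℝ E] {f : ℝ → E}
    {f' : E} {t : ℝ} (h : HasDerivAt (fun s => f (t + s)) f' 0) : HasDerivAt f f' t := by
  have h' : HasDerivAt (fun s => f (t + s)) f' (t - t) := by rwa [sub_self]
  simpa using h'.comp_sub_const t t

namespace IsOneParameterSubgroup
variable {φ : ℝ → G} {X : LieG}

theorem map_zero (hφ : IsOneParameterSubgroup φ X) : φ 0 = 1 := by
  have := hφ.map_add 0 0
  rwa [add_zero, left_eq_mul] at this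

theorem left_zero (hφ : IsOneParameterSubgroup φ X) : (φ 0).left = 1 := by
  rw [hφ.map_zero]; rfl

theorem right_zero (hφ : IsOneParameterSubgroup φ X) : (φ 0).right = 1 := by
  rw [hφ.map_zero]; rfl

theorem smul_one (φ : ℝ → G) (t : ℝ) : φ t • (1 : Heis) = (φ t).left := by
  rw [heis_smul_def, _root_.map_one, mul_one]

theorem left_add (hφ : IsOneParameterSubgroup φ X) (s t : ℝ) :
    (φ (s + t)).left = (φ s).left * rotFun (φ s).right (φ t).left := by
  rw [hφ.map_add]; rfl

theorem right_add (hφ : IsOneParameterSubgroup φ X) (s t : ℝ) :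
    (φ (s + t)).right = (φ s).right * (φ t).right := by
  rw [hφ.map_add]; rfl

/-- The velocity of the orbit `exp (tX) p`, translated to the identity, is `Ad (exp (t a D)) y`. -/
theorem hasDerivAt_left (hφ : IsOneParameterSubgroup φ X) (t : ℝ) :
    HasDerivAt (fun s => (φ s).left)
      (Heis.vec (rotFun (φ t).right X.fst 0) (rotFun (φ t).right X.fst 1)
        (X.fst 2 + ((φ t).left 0 * rotFun (φ t).right X.fst 1 -
          (φ t).left 1 * rotFun (φ t).right X.fst 0) / 2)) t := by
  refine hasDerivAt_of_shift (Heis.hasDerivAt_iff.2 fun i => ?_)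
  have h := Heis.hasDerivAt_iff.1 hφ.velocity_left
  have h0 := ((h 0).const_mul ((φ t).right.1 0 0)).add ((h 1).const_mul ((φ t).right.1 0 1))
  have h1 := ((h 0).const_mul ((φ t).right.1 1 0)).add ((h 1).const_mul ((φ t).right.1 1 1))
  simp only [hφ.left_add]
  fin_cases i
  · exact h0.const_add _
  · exact h1.const_add _
  · refine HasDerivAt.congr_deriv ((((h 2).const_add ((φ t).left 2))).add
      (((h1.const_mul ((φ t).left 0)).sub (h0.const_mul ((φ t).left 1))).div_const 2)) rfl

theorem hasDerivAt_rotFun (hφ : IsOneParameterSubgroup φ X) (y : Heis) (t : ℝ) :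
    HasDerivAt (fun s => rotFun (φ s).right y)
      (Heis.vec (-(X.snd * rotFun (φ t).right y 1)) (X.snd * rotFun (φ t).right y 0) 0) t := by
  refine hasDerivAt_of_shift (Heis.hasDerivAt_iff.2 fun i => ?_)
  -- Differentiation at 0 produces R(Dy), whereas the claim has D(Ry). The relations between the
  -- entries of R express that rotations commute with D.
  obtain ⟨e1, e2, -⟩ := Matrix.mem_specialOrthogonalGroup_fin_two_iff.1 (φ t).right.2
  have h := hφ.velocity_right
  have h0 := ((h 0 0).mul_const (y 0)).add ((h 0 1).mul_const (y 1))
  have h1 := ((h 1 0).mul_const (y 0)).add ((h 1 1).mul_const (y 1))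
  simp only [hφ.right_add, rotFun_mul]
  fin_cases i
  · refine ((h0.const_mul ((φ t).right.1 0 0)).add
      (h1.const_mul ((φ t).right.1 0 1))).congr_deriv ?_
    simp [e1, e2]
    ring
  · refine ((h0.const_mul ((φ t).right.1 1 0)).add
      (h1.const_mul ((φ t).right.1 1 1))).congr_deriv ?_
    simp [e1, e2]
    ring
  · exact hasDerivAt_const _ _

theorem leftTriv_deriv_left (hφ : IsOneParameterSubgroup φ X) (t : ℝ) :
    leftTriv (φ t).left (deriv (fun s => (φ s).left) t) = rotFun (φ t).right X.fst := by
  rw [(hφ.hasDerivAt_left t).deriv]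
  ext
  · simp
  · simp
  · simp only [leftTriv_two, Heis.vec_two, Heis.vec_zero, Heis.vec_one, rotFun_two]
    ring

theorem deriv_left_zero (hφ : IsOneParameterSubgroup φ X) (t : ℝ) :
    deriv (fun s => (φ s).left) t 0 = rotFun (φ t).right X.fst 0 := by
  rw [(hφ.hasDerivAt_left t).deriv, Heis.vec_zero]

theorem deriv_left_one (hφ : IsOneParameterSubgroup φ X) (t : ℝ) :
    deriv (fun s => (φ s).left) t 1 = rotFun (φ t).right X.fst 1 := by
  rw [(hφ.hasDerivAt_left t).deriv, Heis.vec_one]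

end IsOneParameterSubgroup

/-- The rotation through the angle `θ`. -/
def rotation (θ : ℝ) : SO2 :=
  ⟨!![Real.cos θ, -Real.sin θ; Real.sin θ, Real.cos θ],
    Matrix.of_mem_specialOrthogonalGroup_fin_two_iff.2
      ⟨rfl, rfl, by rw [neg_sq, Real.cos_sq_add_sin_sq]⟩⟩

@[simp] theorem rotation_zero_zero (θ : ℝ) : (rotation θ).1 0 0 = Real.cos θ := rfl
@[simp] theorem rotation_zero_one (θ : ℝ) : (rotation θ).1 0 1 = -Real.sin θ := rfl
@[simp] theorem rotation_one_zero (θ : ℝ) : (rotation θ).1 1 0 = Real.sin θ := rfl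
@[simp] theorem rotation_one_one (θ : ℝ) : (rotation θ).1 1 1 = Real.cos θ := rfl

theorem rotation_add (s t : ℝ) : rotation (s + t) = rotation s * rotation t := by
  apply Subtype.ext
  ext i j
  fin_cases i <;> fin_cases j <;>
    simp [Matrix.mul_apply, Fin.sum_univ_two, Real.cos_add, Real.sin_add] <;> ring

theorem rotation_zero : rotation 0 = 1 := by
  apply Subtype.ext
  ext i j
  fin_cases i <;> fin_cases j <;> simp

theorem hasDerivAt_rotation (a : ℝ) (i j : Fin 2) :
    HasDerivAt (fun t => (rotation (a * t)).1 i j)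
      (a * (!![0, -1; 1, 0] : Matrix (Fin 2) (Fin 2) ℝ) i j) 0 := by
  have ha : HasDerivAt (fun t : ℝ => a * t) a 0 := by
    simpa using (hasDerivAt_id (0 : ℝ)).const_mul a
  have hc : HasDerivAt (fun t : ℝ => Real.cos (a * t)) 0 0 := by simpa using ha.cos
  have hs : HasDerivAt (fun t : ℝ => Real.sin (a * t)) a 0 := by simpa using ha.sin
  fin_cases i <;> fin_cases j
  · simpa using hc
  · simpa using hs.fun_neg
  · simpa using hs
  · simpa using hc

/-- Each `X` in `𝔤` generates a one-parameter subgroup. -/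
theorem exists_isOneParameterSubgroup (X : LieG) :
    ∃ φ : ℝ → G, IsOneParameterSubgroup φ X ∧ (∀ t, (φ t).right = rotation (X.snd * t)) ∧
      ContDiff ℝ ∞ fun t => (φ t).left := by
  set a := X.snd with ha
  set y := X.fst with hy
  -- Without rotation the subgroup is the line t y, since [y, y] = 0. Otherwise the projection of
  -- the orbit to the plane is a circle.
  by_cases h0 : a = 0
  · refine ⟨fun t => ⟨t • y, 1⟩, ⟨fun s t => ?_, ?_, fun i j => ?_⟩, fun t => ?_, ?_⟩
    · refine SemidirectProduct.ext ?_ (mul_one (1 : SO2)).symm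
      change (s + t) • y = (s • y) * rotFun 1 (t • y)
      rw [rotFun_one_left]
      ext
      · simp; ring
      · simp; ring
      · simp only [heis_smul_apply, heis_mul_two]; ring
    · simpa using (hasDerivAt_id (0 : ℝ)).smul_const y
    · rw [← ha, h0, zero_mul]
      exact hasDerivAt_const _ _
    · rw [h0, zero_mul, rotation_zero]
    · exact contDiff_id.smul contDiff_const
  -- The center z of that circle: conjugating by z turns y + aD into kE₃ + aD, whose subgroup is
  -- explicit. The extra term in k compensates the E₃-velocity −(y₁² + y₂²)/(2a) produced by the
  -- conjugation.
  · set z : Heis := Heis.vec (-y 1 / a) (y 0 / a) 0 with hz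
    set k : ℝ := y 2 + (y 0 ^ 2 + y 1 ^ 2) / (2 * a) with hk
    set ψ : ℝ → G := fun t => ⟨Heis.vec 0 0 (k * t), rotation (a * t)⟩ with hψ
    set φ : ℝ → G := fun t => SemidirectProduct.inl z * ψ t * (SemidirectProduct.inl z)⁻¹ with hφ
    have hadd : ∀ s t, ψ (s + t) = ψ s * ψ t := by
      intro s t
      refine SemidirectProduct.ext ?_ ?_
      · change Heis.vec 0 0 (k * (s + t)) =
          Heis.vec 0 0 (k * s) * rotFun (rotation (a * s)) (Heis.vec 0 0 (k * t))
        ext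
        · simp
        · simp
        · simp; ring
      · change rotation (a * (s + t)) = rotation (a * s) * rotation (a * t)
        rw [mul_add, rotation_add]
    have hright : ∀ t, (φ t).right = rotation (a * t) := by
      intro t
      simp [hφ, hψ]
    have hleft : ∀ t, (φ t).left =
        z * Heis.vec 0 0 (k * t) * rotFun (rotation (a * t)) z⁻¹ := by
      intro t
      have : (φ t).left = z * rotFun 1 (Heis.vec 0 0 (k * t)) *
        rotFun (1 * rotation (a * t)) (rotFun 1⁻¹ z⁻¹) := rfl
      rw [this, one_mul, inv_one, rotFun_one_left, rotFun_one_left]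
    have hl0 : ∀ t, (φ t).left 0 =
        -y 1 / a + (Real.cos (a * t) * (y 1 / a) + Real.sin (a * t) * (y 0 / a)) := by
      intro t
      rw [hleft]
      simp [hz]
      ring
    have hl1 : ∀ t, (φ t).left 1 =
        y 0 / a + (Real.sin (a * t) * (y 1 / a) - Real.cos (a * t) * (y 0 / a)) := by
      intro t
      rw [hleft]
      simp [hz]
      ring
    have hl2 : ∀ t, (φ t).left 2 =
        k * t - (y 0 ^ 2 + y 1 ^ 2) / (2 * a ^ 2) * Real.sin (a * t) := by
      intro t
      rw [hleft]
      simp [hz]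
      field_simp
      ring
    refine ⟨φ, ⟨fun s t => ?_, ?_, fun i j => ?_⟩, hright, ?_⟩
    · simp only [hφ, hadd]
      group
    · have hat : HasDerivAt (fun t : ℝ => a * t) a 0 := by
        simpa using (hasDerivAt_id (0 : ℝ)).const_mul a
      have hc : HasDerivAt (fun t : ℝ => Real.cos (a * t)) 0 0 := by simpa using hat.cos
      have hs : HasDerivAt (fun t : ℝ => Real.sin (a * t)) a 0 := by simpa using hat.sin
      refine Heis.hasDerivAt_iff.2 fun i => ?_
      fin_cases i
      · simp only [Fin.zero_eta, hl0]
        refine (((hc.mul_const (y 1 / a)).add (hs.mul_const (y 0 / a))).const_add _).congr_deriv ?_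
        field_simp
        ring
      · simp only [Fin.mk_one, hl1]
        refine (((hs.mul_const (y 1 / a)).sub (hc.mul_const (y 0 / a))).const_add _).congr_deriv ?_
        field_simp
        ring
      · simp only [Fin.reduceFinMk, hl2]
        refine (((hasDerivAt_id (0 : ℝ)).const_mul k).sub (hs.const_mul _)).congr_deriv ?_
        rw [hk]
        field_simp
        ring
    · simp only [hright]
      exact hasDerivAt_rotation a i j
    · rw [← contDiffOn_univ]
      refine Heis.contDiffOn_iff.2 fun i => ContDiff.contDiffOn ?_
      fin_cases i
      · simp only [Fin.zero_eta, hl0]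
        fun_prop
      · simp only [Fin.mk_one, hl1]
        fun_prop
      · simp only [Fin.reduceFinMk, hl2]
        fun_prop

/-! ### The Euler–Lagrange equations along orbits, and geodesic vectors. -/

theorem rotFun_sq_add_sq (R : SO2) (y : Heis) :
    rotFun R y 0 ^ 2 + rotFun R y 1 ^ 2 = y 0 ^ 2 + y 1 ^ 2 :=
  R.sq_add_sq _ _

theorem normOf_congr (c : ℝ) {y z : Heis} (h : y 0 ^ 2 + y 1 ^ 2 = z 0 ^ 2 + z 1 ^ 2)
    (h2 : y 2 = z 2) : normOf c y = normOf c z := by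
  have : scalarProduct c y y = scalarProduct c z z := by
    rw [scalarProduct_apply, scalarProduct_apply, h2]
    linear_combination h
  rw [normOf, normOf, this]

theorem normPair_rotFun (c₁ c₂ : ℝ) (R : SO2) (y : Heis) :
    normPair c₁ c₂ (rotFun R y) = normPair c₁ c₂ y := by
  rw [normPair, normPair, normOf_rotFun, normOf_rotFun]

section
variable {c₁ c₂ : ℝ} {L : ℝ × ℝ → ℝ}

theorem horizontalCoeff_rotFun (c₁ c₂ : ℝ) (L : ℝ × ℝ → ℝ) (R : SO2) (y : Heis) :
    horizontalCoeff c₁ c₂ L (rotFun R y) = horizontalCoeff c₁ c₂ L y := by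
  simp only [horizontalCoeff, normPair_rotFun, normOf_rotFun]

theorem verticalCoeff_rotFun (c₁ c₂ : ℝ) (L : ℝ × ℝ → ℝ) (R : SO2) (y : Heis) :
    verticalCoeff c₁ c₂ L (rotFun R y) = verticalCoeff c₁ c₂ L y := by
  simp only [verticalCoeff, normPair_rotFun, normOf_rotFun]

theorem graphOf_congr (c₁ c₂ : ℝ) (L : ℝ × ℝ → ℝ) {y z : Heis}
    (h : y 0 ^ 2 + y 1 ^ 2 = z 0 ^ 2 + z 1 ^ 2) (h2 : y 2 = z 2) :
    graphOf c₁ c₂ L y = graphOf c₁ c₂ L z := by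
  simp only [graphOf, normOf_congr c₁ h h2, normOf_congr c₂ h h2, h2]

theorem halfSq_invariantMetric (c₁ c₂ : ℝ) (L : ℝ × ℝ → ℝ) (x v : Heis) :
    invariantMetric (combinedNorm c₁ c₂ L) x v ^ 2 / 2 = energy c₁ c₂ L (leftTriv x v) := by
  rw [invariantMetric_eq, energy]

/-- The derivative of the energy along the fibre. -/
theorem IsAdmissible.fderiv_fibre (hL : IsAdmissible L) (h₁ : 0 < c₁) (h₂ : 0 < c₂) (x : Heis)
    {v : Heis} (hv : v ≠ 0) (w : Heis) :
    fderiv ℝ (fun v => invariantMetric (combinedNorm c₁ c₂ L) x v ^ 2 / 2) v w =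
      horizontalCoeff c₁ c₂ L (leftTriv x v) * (v 0 * w 0 + v 1 * w 1) +
      verticalCoeff c₁ c₂ L (leftTriv x v) * leftTriv x v 2 *
        (w 2 + (x 1 * w 0 - x 0 * w 1) / 2) := by
  simp only [halfSq_invariantMetric]
  have hu := leftTriv_ne_zero x hv
  have h : HasFDerivAt (fun v => energy c₁ c₂ L (leftTriv x v))
      ((fderiv ℝ (energy c₁ c₂ L) (leftTriv x v)).comp (leftTriv x)) v :=
    ((hL.contDiffAt_energy h₁ h₂ hu).differentiableAt (by simp)).hasFDerivAt.comp v
      (leftTriv x).hasFDerivAt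
  rw [h.fderiv, ContinuousLinearMap.comp_apply, hL.fderiv_energy_apply h₁ h₂ hu]
  simp only [leftTriv_zero, leftTriv_one, leftTriv_two]

/-- The derivative of the energy along the base. -/
theorem IsAdmissible.fderiv_base (hL : IsAdmissible L) (h₁ : 0 < c₁) (h₂ : 0 < c₂) (x : Heis)
    {v : Heis} (hv : v ≠ 0) (w : Heis) :
    fderiv ℝ (fun x => invariantMetric (combinedNorm c₁ c₂ L) x v ^ 2 / 2) x w =
      verticalCoeff c₁ c₂ L (leftTriv x v) * leftTriv x v 2 * ((w 1 * v 0 - w 0 * v 1) / 2) := by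
  simp only [halfSq_invariantMetric]
  have hu := leftTriv_ne_zero x hv
  have hT : HasFDerivAt (fun x => leftTriv x v)
      (Heis.linMap ![0, 0, (v 0 / 2) • Heis.coord 1 - (v 1 / 2) • Heis.coord 0]) x := by
    refine Heis.hasFDerivAt_iff.2 fun i => ?_
    fin_cases i
    · exact hasFDerivAt_const (v 0) x
    · exact hasFDerivAt_const (v 1) x
    · have h := ((((Heis.hasFDerivAt_coord 1 x).mul_const (v 0)).sub
        ((Heis.hasFDerivAt_coord 0 x).mul_const (v 1))).mul_const 2⁻¹).const_add (v 2)
      simp only [Fin.reduceFinMk, leftTriv_two]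
      refine h.congr_fderiv ?_
      ext w
      change 2⁻¹ * (v 0 * w 1 - v 1 * w 0) = v 0 / 2 * w 1 - v 1 / 2 * w 0
      ring
  have h : HasFDerivAt (fun x => energy c₁ c₂ L (leftTriv x v))
      ((fderiv ℝ (energy c₁ c₂ L) (leftTriv x v)).comp
        (Heis.linMap ![0, 0, (v 0 / 2) • Heis.coord 1 - (v 1 / 2) • Heis.coord 0])) x :=
    HasFDerivAt.comp x (f := fun x => leftTriv x v)
      ((hL.contDiffAt_energy h₁ h₂ hu).differentiableAt (by simp)).hasFDerivAt hT
  rw [h.fderiv, ContinuousLinearMap.comp_apply, hL.fderiv_energy_apply h₁ h₂ hu]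
  change _ * (leftTriv x v 0 * 0 + leftTriv x v 1 * 0) +
    _ * (v 0 / 2 * w 1 - v 1 / 2 * w 0) = _
  ring

/-- The left hand side of the Euler-Lagrange equations along an orbit. -/
theorem IsOneParameterSubgroup.hasDerivAt_momentum {φ : ℝ → G} {X : LieG}
    (hφ : IsOneParameterSubgroup φ X) (hL : IsAdmissible L) (h₁ : 0 < c₁) (h₂ : 0 < c₂)
    (hX : X.fst ≠ 0) (w : Heis) (t : ℝ) :
    HasDerivAt (fun s => fderiv ℝ
        (fun v => invariantMetric (combinedNorm c₁ c₂ L) (φ s).left v ^ 2 / 2)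
        (deriv (fun s => (φ s).left) s) w)
      ((horizontalCoeff c₁ c₂ L X.fst * X.snd -
          verticalCoeff c₁ c₂ L X.fst * X.fst 2 / 2) *
        (rotFun (φ t).right X.fst 0 * w 1 - rotFun (φ t).right X.fst 1 * w 0)) t := by
  have hne : ∀ s, deriv (fun s => (φ s).left) s ≠ 0 := by
    intro s h
    have := hφ.leftTriv_deriv_left s
    rw [h, _root_.map_zero] at this
    exact rotFun_ne_zero _ hX this.symm
  have e : ∀ s, fderiv ℝ
        (fun v => invariantMetric (combinedNorm c₁ c₂ L) (φ s).left v ^ 2 / 2)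
        (deriv (fun s => (φ s).left) s) w =
      horizontalCoeff c₁ c₂ L X.fst *
        (rotFun (φ s).right X.fst 0 * w 0 + rotFun (φ s).right X.fst 1 * w 1) +
      verticalCoeff c₁ c₂ L X.fst * X.fst 2 *
        (w 2 + ((φ s).left 1 * w 0 - (φ s).left 0 * w 1) / 2) := by
    intro s
    rw [hL.fderiv_fibre h₁ h₂ _ (hne s), hφ.deriv_left_zero, hφ.deriv_left_one,
      hφ.leftTriv_deriv_left, horizontalCoeff_rotFun, verticalCoeff_rotFun, rotFun_two]
  simp only [e]
  have hr := Heis.hasDerivAt_iff.1 (hφ.hasDerivAt_rotFun X.fst t)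
  have hl := Heis.hasDerivAt_iff.1 (hφ.hasDerivAt_left t)
  refine (((((hr 0).mul_const (w 0)).add ((hr 1).mul_const (w 1))).const_mul
    (horizontalCoeff c₁ c₂ L X.fst)).add ((((((hl 1).mul_const (w 0)).sub
      ((hl 0).mul_const (w 1))).div_const 2).const_add (w 2)).const_mul
        (verticalCoeff c₁ c₂ L X.fst * X.fst 2))).congr_deriv ?_
  simp only [Heis.vec_zero, Heis.vec_one]
  ring

theorem IsOneParameterSubgroup.fderiv_base {φ : ℝ → G} {X : LieG}
    (hφ : IsOneParameterSubgroup φ X) (hL : IsAdmissible L) (h₁ : 0 < c₁) (h₂ : 0 < c₂)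
    (hX : X.fst ≠ 0) (w : Heis) (t : ℝ) :
    fderiv ℝ (fun x => invariantMetric (combinedNorm c₁ c₂ L) x
        (deriv (fun s => (φ s).left) t) ^ 2 / 2) (φ t).left w =
      verticalCoeff c₁ c₂ L X.fst * X.fst 2 / 2 *
        (rotFun (φ t).right X.fst 0 * w 1 - rotFun (φ t).right X.fst 1 * w 0) := by
  have hne : deriv (fun s => (φ s).left) t ≠ 0 := by
    intro h
    have := hφ.leftTriv_deriv_left t
    rw [h, _root_.map_zero] at this
    exact rotFun_ne_zero _ hX this.symm
  rw [hL.fderiv_base h₁ h₂ _ hne, hφ.deriv_left_zero, hφ.deriv_left_one, hφ.leftTriv_deriv_left, verticalCoeff_rotFun,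
    rotFun_two]
  ring

/-- Both sides of the Euler–Lagrange equation are the same linear form in w, with coefficients S a −
T y₃/2 and T y₃/2. They agree as soon as S a = T y₃. -/
theorem IsAdmissible.isGeodesicVector_graphOf (hL : IsAdmissible L) (h₁ : 0 < c₁) (h₂ : 0 < c₂)
    {y : Heis} (hy : y ≠ 0) :
    IsGeodesicVector (invariantMetric (combinedNorm c₁ c₂ L))
      (LieG.mk y (graphOf c₁ c₂ L y)) := by
  obtain ⟨φ, hφ, -, hsm⟩ := exists_isOneParameterSubgroup (LieG.mk y (graphOf c₁ c₂ L y))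
  refine ⟨fun t => (φ t).left,
    ⟨φ, hφ, fun t _ => (IsOneParameterSubgroup.smul_one φ t).symm⟩,
    ⟨hsm.contDiffOn, fun t _ h => ?_, fun t _ w => ?_⟩⟩
  · have := hφ.leftTriv_deriv_left t
    rw [h, _root_.map_zero] at this
    exact rotFun_ne_zero _ hy this.symm
  · rw [hφ.fderiv_base hL h₁ h₂ hy]
    refine (hφ.hasDerivAt_momentum hL h₁ h₂ hy w t).congr_deriv ?_
    have hS := (hL.horizontalCoeff_pos h₁ h₂ hy).ne'
    have : horizontalCoeff c₁ c₂ L y * graphOf c₁ c₂ L y = verticalCoeff c₁ c₂ L y * y 2 := by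
      rw [graphOf_eq]
      field_simp
    simp only [LieG.fst_mk, LieG.snd_mk, this]
    ring

/-- The converse needs y off the E₃-axis: on the axis that linear form is zero and puts no condition
on a. -/
theorem IsAdmissible.snd_eq_graphOf (hL : IsAdmissible L) (h₁ : 0 < c₁) (h₂ : 0 < c₂)
    {X : LieG} (hX : IsGeodesicVector (invariantMetric (combinedNorm c₁ c₂ L)) X)
    (hy : X.fst 0 ≠ 0 ∨ X.fst 1 ≠ 0) : X.snd = graphOf c₁ c₂ L X.fst := by
  obtain ⟨γ, ⟨φ, hφ, hγ⟩, hgeo⟩ := hX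
  have hγ' : γ = fun t => (φ t).left := by
    funext t
    rw [hγ t trivial, IsOneParameterSubgroup.smul_one]
  subst hγ'
  have hX0 : X.fst ≠ 0 := Heis.ne_zero_iff.2 (hy.imp_right Or.inl)
  -- Testing against the quarter turn of the horizontal part of y makes the common linear form equal
  -- to y₁² + y₂² > 0, which can be cancelled.
  have h := (hgeo.euler_lagrange 0 trivial (Heis.vec (-X.fst 1) (X.fst 0) 0)).unique
    (hφ.hasDerivAt_momentum hL h₁ h₂ hX0 _ 0)
  rw [hφ.fderiv_base hL h₁ h₂ hX0, hφ.right_zero, rotFun_one_left] at h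
  simp only [Heis.vec_zero, Heis.vec_one] at h
  have hr : 0 < X.fst 0 ^ 2 + X.fst 1 ^ 2 := by
    rcases hy with h | h <;> positivity
  have hS := hL.horizontalCoeff_pos h₁ h₂ hX0
  have key : horizontalCoeff c₁ c₂ L X.fst * X.snd = verticalCoeff c₁ c₂ L X.fst * X.fst 2 := by
    apply mul_right_cancel₀ hr.ne'
    linear_combination -h
  rw [graphOf_eq, div_mul_eq_mul_div, eq_div_iff hS.ne', mul_comm, key]

/-! ### Every geodesic through p is an orbit. -/

/-- The Hessian of the energy is nondegenerate, so that the Euler-Poincaré equations determine the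
derivative `z` of the left-trivialized velocity `u`. -/
theorem IsAdmissible.velocity_eq (hL : IsAdmissible L) (h₁ : 0 < c₁) (h₂ : 0 < c₂)
    {u z : Heis} (hu : u ≠ 0)
    (hz0 : fderiv ℝ (fderiv ℝ (energy c₁ c₂ L)) u z (Heis.vec 1 0 0) =
      -(verticalCoeff c₁ c₂ L u * u 2 * u 1))
    (hz1 : fderiv ℝ (fderiv ℝ (energy c₁ c₂ L)) u z (Heis.vec 0 1 0) =
      verticalCoeff c₁ c₂ L u * u 2 * u 0)
    (hz2 : fderiv ℝ (fderiv ℝ (energy c₁ c₂ L)) u z (Heis.vec 0 0 1) = 0) :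
    z = Heis.vec (-(graphOf c₁ c₂ L u * u 1)) (graphOf c₁ c₂ L u * u 0) 0 := by
  set κ := graphOf c₁ c₂ L u with hκ
  obtain ⟨φ, hφ, -, -⟩ := exists_isOneParameterSubgroup (LieG.mk u κ)
  have hr := hφ.hasDerivAt_rotFun u 0
  have hu0 : rotFun (φ 0).right u = u := by rw [hφ.right_zero, rotFun_one_left]
  simp only [hu0, LieG.snd_mk] at hr
  have hcomp : HasDerivAt (fun s => fderiv ℝ (energy c₁ c₂ L) (rotFun (φ s).right u))
      (fderiv ℝ (fderiv ℝ (energy c₁ c₂ L)) u (Heis.vec (-(κ * u 1)) (κ * u 0) 0)) 0 :=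
    HasFDerivAt.comp_hasDerivAt (0 : ℝ) (f := fun s => rotFun (φ s).right u)
      (by rw [hu0]; exact hL.hasFDerivAt_fderiv_energy h₁ h₂ hu) hr
  -- The Hessian in the rotational direction comes from differentiating dE along a rotating u. There
  -- S, T and u₃ are constant, so no second derivatives of L appear.
  have hrot : ∀ w : Heis, fderiv ℝ (fderiv ℝ (energy c₁ c₂ L)) u
      (Heis.vec (-(κ * u 1)) (κ * u 0) 0) w =
        horizontalCoeff c₁ c₂ L u * (-(κ * u 1) * w 0 + κ * u 0 * w 1) := by
    intro w
    have h := hcomp.clm_apply (hasDerivAt_const (0 : ℝ) w)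
    simp only [hL.fderiv_energy_apply h₁ h₂ (rotFun_ne_zero _ hu), horizontalCoeff_rotFun,
      verticalCoeff_rotFun, rotFun_two] at h
    have h' := Heis.hasDerivAt_iff.1 hr
    have h3 := ((((h' 0).mul_const (w 0)).add ((h' 1).mul_const (w 1))).const_mul
      (horizontalCoeff c₁ c₂ L u)).add_const (verticalCoeff c₁ c₂ L u * u 2 * w 2)
    simpa using h.unique h3
  have hSκ : horizontalCoeff c₁ c₂ L u * κ = verticalCoeff c₁ c₂ L u * u 2 := by
    have := (hL.horizontalCoeff_pos h₁ h₂ hu).ne'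
    rw [hκ, graphOf_eq]
    field_simp
  set J := Heis.vec (-(κ * u 1)) (κ * u 0) 0
  -- The candidate J solves the same three equations as z, so E'' annihilates the pair (z − J, z −
  -- J). Positive definiteness then forces z = J.
  by_contra hne
  have hpos := hL.fderiv_fderiv_energy_pos h₁ h₂ hu (sub_ne_zero.2 hne)
  set d := z - J
  have hd : d = d 0 • Heis.vec 1 0 0 + d 1 • Heis.vec 0 1 0 + d 2 • Heis.vec 0 0 1 := by
    ext <;> simp
  have hzero : ∀ w : Heis, fderiv ℝ (fderiv ℝ (energy c₁ c₂ L)) u d w =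
      fderiv ℝ (fderiv ℝ (energy c₁ c₂ L)) u z w -
        horizontalCoeff c₁ c₂ L u * (-(κ * u 1) * w 0 + κ * u 0 * w 1) := by
    intro w
    rw [← hrot w, map_sub]
    rfl
  have : fderiv ℝ (fderiv ℝ (energy c₁ c₂ L)) u d d = 0 := by
    conv_lhs => rw [show fderiv ℝ (fderiv ℝ (energy c₁ c₂ L)) u d d =
      fderiv ℝ (fderiv ℝ (energy c₁ c₂ L)) u d (d 0 • Heis.vec 1 0 0 + d 1 • Heis.vec 0 1 0 +
        d 2 • Heis.vec 0 0 1) from congrArg _ hd]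
    rw [map_add, map_add, map_smul, map_smul, map_smul, hzero, hzero, hzero, hz0, hz1, hz2]
    simp only [Heis.vec_zero, Heis.vec_one, smul_eq_mul]
    linear_combination (d 0 * u 1 - d 1 * u 0) * hSκ
  exact hpos.ne' this

/-- The Euler-Lagrange equations of an invariant metric, in terms of the velocity translated to
the identity: it is rotated with the angular velocity `ξ`. -/
theorem IsGeodesicOn.hasDerivAt_leftTriv (hL : IsAdmissible L) (h₁ : 0 < c₁) (h₂ : 0 < c₂)
    {γ : ℝ → Heis} {I : Set ℝ} (hI : IsOpen I)
    (hγ : IsGeodesicOn (invariantMetric (combinedNorm c₁ c₂ L)) γ I) {t : ℝ} (ht : t ∈ I) :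
    HasDerivAt (fun s => leftTriv (γ s) (deriv γ s))
      (Heis.vec (-(graphOf c₁ c₂ L (leftTriv (γ t) (deriv γ t)) * deriv γ t 1))
        (graphOf c₁ c₂ L (leftTriv (γ t) (deriv γ t)) * deriv γ t 0) 0) t := by
  have hγt : ContDiffAt ℝ ∞ γ t := hγ.smooth.contDiffAt (hI.mem_nhds ht)
  have hγd : HasDerivAt γ (deriv γ t) t := (hγt.differentiableAt (by simp)).hasDerivAt
  have hγ' : ContDiffAt ℝ ∞ (deriv γ) t :=
    ((contDiffOn_infty_iff_deriv_of_isOpen hI).1 hγ.smooth).2.contDiffAt (hI.mem_nhds ht)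
  have hu : DifferentiableAt ℝ (fun s => leftTriv (γ s) (deriv γ s)) t :=
    (ContDiffAt.comp t (f := fun s => (γ s, deriv γ s))
      (contDiff_leftTriv (n := ∞)).contDiffAt (hγt.prodMk hγ')).differentiableAt (by simp)
  obtain ⟨z, hz⟩ : ∃ z, HasDerivAt (fun s => leftTriv (γ s) (deriv γ s)) z t :=
    ⟨_, hu.hasDerivAt⟩
  set u := fun s => leftTriv (γ s) (deriv γ s) with hudef
  have hune : ∀ s ∈ I, u s ≠ 0 := fun s hs => leftTriv_ne_zero _ (hγ.regular s hs)
  have hH : ∀ w, HasDerivAt (fun s => fderiv ℝ (energy c₁ c₂ L) (u s) w)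
      (fderiv ℝ (fderiv ℝ (energy c₁ c₂ L)) (u t) z w) t := by
    intro w
    have h : HasDerivAt (fun s => fderiv ℝ (energy c₁ c₂ L) (u s))
        (fderiv ℝ (fderiv ℝ (energy c₁ c₂ L)) (u t) z) t :=
      HasFDerivAt.comp_hasDerivAt t (hL.hasFDerivAt_fderiv_energy h₁ h₂ (hune t ht)) hz
    simpa using h.clm_apply (hasDerivAt_const t w)
  set P : ℝ → ℝ := fun s => fderiv ℝ (energy c₁ c₂ L) (u s) (Heis.vec 0 0 1) with hP
  have hPval : ∀ s ∈ I, P s = verticalCoeff c₁ c₂ L (u s) * u s 2 := by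
    intro s hs
    rw [hP]
    simp only [hL.fderiv_energy_apply h₁ h₂ (hune s hs)]
    simp
  have hEL : ∀ w : Heis, HasDerivAt (fun s => fderiv ℝ (energy c₁ c₂ L) (u s) w +
      P s * ((γ s 1 * w 0 - γ s 0 * w 1) / 2))
      (P t * ((w 1 * deriv γ t 0 - w 0 * deriv γ t 1) / 2)) t := by
    intro w
    have h := hγ.euler_lagrange t ht w
    rw [hL.fderiv_base h₁ h₂ _ (hγ.regular t ht)] at h
    rw [hPval t ht]
    refine h.congr_of_eventuallyEq ?_
    filter_upwards [hI.mem_nhds ht] with s hs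
    rw [hL.fderiv_fibre h₁ h₂ _ (hγ.regular s hs), hPval s hs,
      hL.fderiv_energy_apply h₁ h₂ (hune s hs)]
    simp only [hudef, leftTriv_zero, leftTriv_one]
    ring
  have hg := Heis.hasDerivAt_iff.1 hγd
  -- Testing against E₃: the energy does not change along central directions, so the E₃-momentum is
  -- conserved.
  have hP0 : HasDerivAt P 0 t := by
    have h := hEL (Heis.vec 0 0 1)
    simpa using h
  have e2 : fderiv ℝ (fderiv ℝ (energy c₁ c₂ L)) (u t) z (Heis.vec 0 0 1) = 0 :=
    (hH _).unique hP0
  -- Half of the bracket term comes from the moving base point in the momentum and half from the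
  -- base derivative; with P' = 0 they add up to the full term. The equation for E₂ is analogous.
  have e0 : fderiv ℝ (fderiv ℝ (energy c₁ c₂ L)) (u t) z (Heis.vec 1 0 0) =
      -(verticalCoeff c₁ c₂ L (u t) * u t 2 * u t 1) := by
    have h := hEL (Heis.vec 1 0 0)
    simp only [Heis.vec_zero, Heis.vec_one] at h
    have h' := (hH (Heis.vec 1 0 0)).add
      (hP0.mul (((((hg 1).mul_const 1).sub ((hg 0).mul_const 0))).div_const 2))
    have := h.unique h'
    rw [← hPval t ht]
    simp only [hudef, leftTriv_one]
    linear_combination -this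
  have e1 : fderiv ℝ (fderiv ℝ (energy c₁ c₂ L)) (u t) z (Heis.vec 0 1 0) =
      verticalCoeff c₁ c₂ L (u t) * u t 2 * u t 0 := by
    have h := hEL (Heis.vec 0 1 0)
    simp only [Heis.vec_zero, Heis.vec_one] at h
    have h' := (hH (Heis.vec 0 1 0)).add
      (hP0.mul (((((hg 1).mul_const 0).sub ((hg 0).mul_const 1))).div_const 2))
    have := h.unique h'
    rw [← hPval t ht]
    simp only [hudef, leftTriv_zero]
    linear_combination -this
  have hfin := hL.velocity_eq h₁ h₂ (hune t ht) e0 e1 e2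
  rw [hfin] at hz
  exact hz

theorem eq_of_hasDerivAt_zero {I : Set ℝ} (hI : IsOpen I) (hI' : I.OrdConnected) {f : ℝ → ℝ}
    (hf : ∀ t ∈ I, HasDerivAt f 0 t) {s t : ℝ} (hs : s ∈ I) (ht : t ∈ I) : f s = f t :=
  hI.is_const_of_deriv_eq_zero hI'.isPreconnected
    (fun t ht => (hf t ht).differentiableAt.differentiableWithinAt)
    (fun t ht => (hf t ht).deriv) hs ht

/-- The angular speed of u depends only on u₁² + u₂² and u₃, which the rotation preserves; hence it
is a constant a. The curve then has the same starting point and the same translated velocity as the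
orbit of u(0) + aD, and the two coincide. -/
theorem IsAdmissible.isGeodesicOrbit (hL : IsAdmissible L) (h₁ : 0 < c₁) (h₂ : 0 < c₂) :
    IsGeodesicOrbit (invariantMetric (combinedNorm c₁ c₂ L)) := by
  intro I γ hI hI' h0 hγ hγ0
  set u := fun s => leftTriv (γ s) (deriv γ s) with hu
  have hud := fun t ht => IsGeodesicOn.hasDerivAt_leftTriv hL h₁ h₂ hI hγ (t := t) ht
  have hγd : ∀ t ∈ I, HasDerivAt γ (deriv γ t) t := fun t ht =>
    ((hγ.smooth.contDiffAt (hI.mem_nhds ht)).differentiableAt (by simp)).hasDerivAt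
  set a := graphOf c₁ c₂ L (u 0) with ha
  have hconst : ∀ t ∈ I, graphOf c₁ c₂ L (u t) = a := by
    intro t ht
    refine graphOf_congr _ _ _ ?_ ?_
    · refine eq_of_hasDerivAt_zero hI hI' (f := fun t => u t 0 ^ 2 + u t 1 ^ 2) ?_ ht h0
      intro s hs
      have h := Heis.hasDerivAt_iff.1 (hud s hs)
      refine (((h 0).pow 2).add ((h 1).pow 2)).congr_deriv ?_
      simp only [Heis.vec_zero, Heis.vec_one, leftTriv_zero, leftTriv_one]
      ring
    · exact eq_of_hasDerivAt_zero hI hI' (f := fun t => u t 2)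
        (fun s hs => Heis.hasDerivAt_iff.1 (hud s hs) 2) ht h0
  obtain ⟨φ, hφ, hright, -⟩ := exists_isOneParameterSubgroup (LieG.mk (u 0) a)
  have hrot : ∀ t, HasDerivAt (fun t : ℝ => a * t) a t := fun t => by
    simpa using (hasDerivAt_id t).const_mul a
  -- Rotating u back through the angle a t gives constant coordinates, which replaces an appeal to
  -- uniqueness for differential equations.
  have hcs : ∀ t ∈ I, Real.cos (a * t) * u t 0 + Real.sin (a * t) * u t 1 = u 0 0 := by
    intro t ht
    have := eq_of_hasDerivAt_zero hI hI'
      (f := fun t => Real.cos (a * t) * u t 0 + Real.sin (a * t) * u t 1) (fun s hs => by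
        have h := Heis.hasDerivAt_iff.1 (hud s hs)
        refine (((hrot s).cos.mul (h 0)).add ((hrot s).sin.mul (h 1))).congr_deriv ?_
        have hs' := hconst s hs
        simp only [hu] at hs'
        simp only [Heis.vec_zero, Heis.vec_one, leftTriv_zero, leftTriv_one, hs']
        ring) ht h0
    simpa using this
  have hsc : ∀ t ∈ I, -Real.sin (a * t) * u t 0 + Real.cos (a * t) * u t 1 = u 0 1 := by
    intro t ht
    have := eq_of_hasDerivAt_zero hI hI'
      (f := fun t => -Real.sin (a * t) * u t 0 + Real.cos (a * t) * u t 1) (fun s hs => by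
        have h := Heis.hasDerivAt_iff.1 (hud s hs)
        refine (((hrot s).sin.fun_neg.mul (h 0)).add ((hrot s).cos.mul (h 1))).congr_deriv ?_
        have hs' := hconst s hs
        simp only [hu] at hs'
        simp only [Heis.vec_zero, Heis.vec_one, leftTriv_zero, leftTriv_one, hs']
        ring) ht h0
    simpa using this
  have hurot : ∀ t ∈ I, u t = rotFun (φ t).right (u 0) := by
    intro t ht
    have hsq := Real.cos_sq_add_sin_sq (a * t)
    rw [hright]
    ext
    · rw [rotFun_zero, ← hcs t ht, ← hsc t ht]
      simp only [LieG.snd_mk, rotation_zero_zero, rotation_zero_one]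
      linear_combination -(u t 0) * hsq
    · rw [rotFun_one, ← hcs t ht, ← hsc t ht]
      simp only [LieG.snd_mk, rotation_one_zero, rotation_one_one]
      linear_combination -(u t 1) * hsq
    · exact eq_of_hasDerivAt_zero hI hI' (f := fun t => u t 2)
        (fun s hs => Heis.hasDerivAt_iff.1 (hud s hs) 2) ht h0
  have hd0 : ∀ t ∈ I, deriv γ t 0 = rotFun (φ t).right (u 0) 0 :=
    fun t ht => congrFun (hurot t ht) 0
  have hd1 : ∀ t ∈ I, deriv γ t 1 = rotFun (φ t).right (u 0) 1 :=
    fun t ht => congrFun (hurot t ht) 1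
  have hd2 : ∀ t ∈ I, deriv γ t 2 + (γ t 1 * deriv γ t 0 - γ t 0 * deriv γ t 1) / 2 = u 0 2 :=
    fun t ht => by
      rw [← leftTriv_two]
      exact (congrFun (hurot t ht) 2).trans (rotFun_two _ _)
  have hl : ∀ t i, HasDerivAt (fun s => (φ s).left i) _ t := fun t i =>
    Heis.hasDerivAt_iff.1 (hφ.hasDerivAt_left t) i
  have g0 : ∀ t ∈ I, γ t 0 = (φ t).left 0 := by
    intro t ht
    have := eq_of_hasDerivAt_zero hI hI' (f := fun t => γ t 0 - (φ t).left 0) (fun s hs => by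
      refine ((Heis.hasDerivAt_iff.1 (hγd s hs) 0).sub (hl s 0)).congr_deriv ?_
      simp [hd0 s hs]) ht h0
    simp only [hγ0, hφ.left_zero, sub_self] at this
    exact sub_eq_zero.1 this
  have g1 : ∀ t ∈ I, γ t 1 = (φ t).left 1 := by
    intro t ht
    have := eq_of_hasDerivAt_zero hI hI' (f := fun t => γ t 1 - (φ t).left 1) (fun s hs => by
      refine ((Heis.hasDerivAt_iff.1 (hγd s hs) 1).sub (hl s 1)).congr_deriv ?_
      simp [hd1 s hs]) ht h0
    simp only [hγ0, hφ.left_zero, sub_self] at this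
    exact sub_eq_zero.1 this
  -- The E₃-coordinate comes last, because its velocity involves the first two coordinates of the
  -- curve.
  have g2 : ∀ t ∈ I, γ t 2 = (φ t).left 2 := by
    intro t ht
    have := eq_of_hasDerivAt_zero hI hI' (f := fun t => γ t 2 - (φ t).left 2) (fun s hs => by
      refine ((Heis.hasDerivAt_iff.1 (hγd s hs) 2).sub (hl s 2)).congr_deriv ?_
      have h2 := hd2 s hs
      rw [hd0 s hs, hd1 s hs, g0 s hs, g1 s hs] at h2
      simp only [Heis.vec_two, LieG.fst_mk]
      linear_combination h2) ht h0
    simp only [hγ0, hφ.left_zero, sub_self] at this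
    exact sub_eq_zero.1 this
  exact ⟨_, φ, hφ, fun t ht => by
    rw [IsOneParameterSubgroup.smul_one]
    exact Heis.ext (g0 t ht) (g1 t ht) (g2 t ht)⟩

end

/-! ### Natural reductivity of the Riemannian metrics. -/

/-- The complement is 𝔪 = {y + c y₃ D}. On it ⟨[z, x]_𝔪, y⟩ is, up to sign, c times the determinant
of the `𝔫`-components of x, y, z. It is therefore skew in x and y. -/
theorem isNaturallyReductiveRiemannian_scalarProduct {c : ℝ} (hc : 0 < c) :
    IsNaturallyReductiveRiemannian (scalarProduct c) where
  symm x y := by simp only [scalarProduct_apply]; ring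
  pos x hx := scalarProduct_self_pos hc hx
  invariant := scalarProduct_rotFun c
  naturallyReductive := by
    set ℓ : LieG →ₗ[ℝ] ℝ :=
      LieG.snd - c • ((Heis.coord 2 : Heis →ₗ[ℝ] ℝ).comp LieG.fst) with hℓ
    have hmem : ∀ X, X ∈ LinearMap.ker ℓ ↔ X.snd = c * X.fst 2 := by
      intro X
      rw [LinearMap.mem_ker]
      exact sub_eq_zero
    refine ⟨LinearMap.ker ℓ, ⟨⟨?_, ?_⟩, ?_⟩, ?_⟩
    · rw [Submodule.disjoint_def]
      intro X hX hX'
      have h0 : X.fst = 0 := hX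
      rw [hmem, h0] at hX'
      exact Prod.ext h0 (hX'.trans (mul_zero c))
    · rw [Submodule.codisjoint_iff_exists_add_eq]
      intro X
      refine ⟨LieG.mk 0 (X.snd - c * X.fst 2), LieG.mk X.fst (c * X.fst 2), rfl,
        (hmem _).2 rfl, ?_⟩
      ext <;> simp
    · intro R X hX
      exact (hmem _).2 ((hmem _).1 hX)
    · intro x hx y hy z hz
      rw [hmem] at hx hy hz
      simp only [scalarProduct_apply, bracket_fst_zero, bracket_fst_one, bracket_fst_two,
        hx, hy, hz]
      ring

/-! ### The geodesic graph: continuity, uniqueness, and linearity in the naturally reductive case.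
-/

section
variable {c₁ c₂ : ℝ} {L : ℝ × ℝ → ℝ}

/-- Away from 0 the coefficient of y₃ is a weighted mean of c₁ and c₂ with nonnegative weights. The
bound yields continuity at 0, where the coefficient itself need not have a limit. -/
theorem IsAdmissible.abs_graphOf_le (hL : IsAdmissible L) (h₁ : 0 < c₁) (h₂ : 0 < c₂) (y : Heis) :
    |graphOf c₁ c₂ L y| ≤ (c₁ + c₂) * |y 2| := by
  rcases eq_or_ne y 0 with rfl | hy
  · simp [graphOf]
  have hq := normPair_mem h₁ h₂ hy
  have b₁ := div_nonneg (hL.partial₁_nonneg _ hq) (normOf_pos h₁ hy).le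
  have b₂ := div_nonneg (hL.partial₂_nonneg _ hq) (normOf_pos h₂ hy).le
  have hS := hL.horizontalCoeff_pos h₁ h₂ hy
  rw [graphOf_eq, abs_mul]
  refine mul_le_mul_of_nonneg_right ?_ (abs_nonneg _)
  have hT : 0 ≤ verticalCoeff c₁ c₂ L y := by
    rw [verticalCoeff]
    positivity
  rw [abs_of_nonneg (div_nonneg hT hS.le), div_le_iff₀ hS, verticalCoeff, horizontalCoeff]
  nlinarith [mul_nonneg h₁.le b₂, mul_nonneg h₂.le b₁]

theorem IsAdmissible.continuous_graphOf (hL : IsAdmissible L) (h₁ : 0 < c₁) (h₂ : 0 < c₂) :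
    Continuous (graphOf c₁ c₂ L) := by
  rw [continuous_iff_continuousAt]
  intro y
  rcases eq_or_ne y 0 with rfl | hy
  · have h0 : graphOf c₁ c₂ L 0 = 0 := by simp [graphOf]
    rw [ContinuousAt, h0]
    refine squeeze_zero_norm (fun z => hL.abs_graphOf_le h₁ h₂ z) ?_
    have : Continuous fun z : Heis => (c₁ + c₂) * |z 2| := by fun_prop
    simpa using this.tendsto (0 : Heis)
  · have hq := normPair_mem h₁ h₂ hy
    have hd : ContinuousAt (fun z => fderiv ℝ L (normPair c₁ c₂ z)) y :=
      ContinuousAt.comp (f := normPair c₁ c₂) (hL.hasFDerivAt_fderiv hq).continuousAt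
        (hasFDerivAt_normPair h₁ h₂ hy).continuousAt
    have hd1 : ContinuousAt (fun z => partial₁ L (normPair c₁ c₂ z) / normOf c₁ z) y :=
      (hd.clm_apply continuousAt_const).div (continuous_normOf c₁).continuousAt
        (normOf_pos h₁ hy).ne'
    have hd2 : ContinuousAt (fun z => partial₂ L (normPair c₁ c₂ z) / normOf c₂ z) y :=
      (hd.clm_apply continuousAt_const).div (continuous_normOf c₂).continuousAt
        (normOf_pos h₂ hy).ne'
    have hS : ContinuousAt (horizontalCoeff c₁ c₂ L) y := (hd1.add hd2).div_const 2
    have hT : ContinuousAt (verticalCoeff c₁ c₂ L) y :=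
      ((hd1.const_mul c₁).add (hd2.const_mul c₂)).div_const 2
    have h := (hT.div hS (hL.horizontalCoeff_pos h₁ h₂ hy).ne').mul
      (Heis.continuous_coord 2).continuousAt
    exact h.congr (Filter.Eventually.of_forall fun z => (graphOf_eq c₁ c₂ L z).symm)

theorem IsAdmissible.isUniqueGeodesicGraph (hL : IsAdmissible L) (h₁ : 0 < c₁) (h₂ : 0 < c₂) :
    IsUniqueGeodesicGraph (invariantMetric (combinedNorm c₁ c₂ L)) (graphOf c₁ c₂ L) := by
  refine ⟨hL.continuous_graphOf h₁ h₂, ⟨fun R y => ?_, fun y hy => ?_⟩, fun η hη y hy => ?_⟩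
  · have h : graphOf c₁ c₂ L (rotFun R y) = graphOf c₁ c₂ L y :=
      graphOf_congr _ _ _ (rotFun_sq_add_sq R y) rfl
    rw [h]
    ext <;> simp [Ad]
  · exact hL.isGeodesicVector_graphOf h₁ h₂ hy
  · exact hL.snd_eq_graphOf h₁ h₂
      (hη.2 y (Heis.ne_zero_iff.2 (hy.imp_right Or.inl))) hy

/-- Continuous functions which agree where the component in the plane of `E₁` and `E₂` is nonzero
are equal. -/
theorem eq_of_eqOn_horizontal {f g : Heis → ℝ} (hf : Continuous f) (hg : Continuous g)
    (h : ∀ y : Heis, (y 0 ≠ 0 ∨ y 1 ≠ 0) → f y = g y) : f = g := by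
  funext y
  by_cases hy : y 0 ≠ 0 ∨ y 1 ≠ 0
  · exact h y hy
  push Not at hy
  -- Points of the E₃-axis are approached in the direction E₁, along which only the parameter s = 0
  -- lies on the axis.
  have hline : Continuous fun s : ℝ => y + s • Heis.vec 1 0 0 := by fun_prop
  have hd : Dense {s : ℝ | s ≠ 0} := dense_compl_singleton 0
  have := Continuous.ext_on hd (hf.comp hline) (hg.comp hline) (fun s hs => by
    refine h _ (Or.inl ?_)
    simpa [hy.1] using hs)
  simpa using congrFun this 0

/-- Invariance under rotation leaves no room for a horizontal contribution to the `D`-component on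
𝔪, so that component is b y₃. Geodesic vectors off the axis are determined by their `𝔫`-component,
hence the graph is b y₃ there. -/
theorem IsAdmissible.isLinearMap_graphOf (hL : IsAdmissible L) (h₁ : 0 < c₁) (h₂ : 0 < c₂)
    (hF : IsNaturallyReductive (invariantMetric (combinedNorm c₁ c₂ L))) :
    IsLinearMap ℝ (graphOf c₁ c₂ L) := by
  obtain ⟨m, ⟨hm, hAd⟩, hgeo⟩ := hF
  obtain ⟨A, B, hA, hB, hAB⟩ :=
    Submodule.codisjoint_iff_exists_add_eq.1 hm.codisjoint (LieG.mk (Heis.vec 0 0 1) 0)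
  have hB1 : B.fst = Heis.vec 0 0 1 := by
    have := congrArg LieG.fst hAB
    rw [map_add, show A.fst = 0 from hA, zero_add] at this
    exact this
  have hdisj := Submodule.disjoint_def.1 hm.disjoint
  have hsnd : ∀ X ∈ m, X.snd = B.snd * X.fst 2 := by
    intro X hX
    -- The half turn negates the horizontal part, so the sum has `𝔫`-component 2 X₃ E₃. Subtracting
    -- 2 X₃ B leaves an element of 𝔪 ∩ `𝔥` = 0, and its `D`-component gives the formula.
    have hm' : X + Ad (rotation Real.pi) X - (2 * X.fst 2) • B ∈ m :=
      m.sub_mem (m.add_mem hX (hAd _ _ hX)) (m.smul_mem _ hB)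
    have hker : X + Ad (rotation Real.pi) X - (2 * X.fst 2) • B ∈ isotropyAlgebra := by
      change LieG.fst _ = 0
      rw [map_sub, map_add, map_smul, hB1]
      ext <;> simp [Ad]
      ring
    have h := congrArg LieG.snd (hdisj _ hker hm')
    simp only [map_sub, map_add, map_smul, Ad, LieG.snd_mk, smul_eq_mul,
      show LieG.snd 0 = 0 from rfl] at h
    linear_combination h / 2
  have hξ : graphOf c₁ c₂ L = fun y => B.snd * y 2 := by
    refine eq_of_eqOn_horizontal (hL.continuous_graphOf h₁ h₂) (by fun_prop) fun y hy => ?_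
    have hy0 : y ≠ 0 := Heis.ne_zero_iff.2 (hy.imp_right Or.inl)
    obtain ⟨γ, ⟨φ, hφ, hγφ⟩, hγ⟩ := hL.isGeodesicVector_graphOf h₁ h₂ hy0
    have hγ0 : γ 0 = 1 := by
      rw [hγφ 0 trivial, IsOneParameterSubgroup.smul_one, hφ.left_zero]
    obtain ⟨X, hXm, hX⟩ := hgeo Set.univ γ isOpen_univ Set.ordConnected_univ trivial hγ hγ0
    -- The vector supplied by natural reductivity generates the same curve, so its initial velocity
    -- is again y.
    have hXy : X.fst = y := by
      obtain ⟨ψ, hψ, hγψ⟩ := hX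
      have e : (fun t => (ψ t).left) = fun t => (φ t).left := by
        funext t
        rw [← IsOneParameterSubgroup.smul_one, ← IsOneParameterSubgroup.smul_one,
          ← hγφ t trivial, ← hγψ t trivial]
      have hv := hψ.velocity_left
      rw [e] at hv
      exact hv.unique hφ.velocity_left
    have h := hL.snd_eq_graphOf h₁ h₂ (X := X) ⟨γ, hX, hγ⟩ (by rwa [hXy])
    rw [hsnd X hXm, hXy] at h
    exact h.symm
  rw [hξ]
  exact ⟨fun x y => by simp; ring, fun r x => by simp; ring⟩

end

/-! The `(α₁, α₂)`-type. -/

/-- The plane spanned by `E₁` and `E₂`. -/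
def horizontalPlane : Submodule ℝ Heis := LinearMap.ker (Heis.coord 2 : Heis →ₗ[ℝ] ℝ)

/-- The line spanned by `E₃`. -/
def verticalLine : Submodule ℝ Heis :=
  LinearMap.ker (Heis.coord 0 : Heis →ₗ[ℝ] ℝ) ⊓ LinearMap.ker (Heis.coord 1 : Heis →ₗ[ℝ] ℝ)

theorem mem_horizontalPlane {x : Heis} : x ∈ horizontalPlane ↔ x 2 = 0 := Iff.rfl

theorem mem_verticalLine {x : Heis} : x ∈ verticalLine ↔ x 0 = 0 ∧ x 1 = 0 := Iff.rfl

theorem isCompl_horizontal_vertical : IsCompl horizontalPlane verticalLine := by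
  constructor
  · rw [Submodule.disjoint_def]
    intro x hx hx'
    exact Heis.ext hx'.1 hx'.2 hx
  · rw [Submodule.codisjoint_iff_exists_add_eq]
    intro x
    refine ⟨Heis.vec (x 0) (x 1) 0, Heis.vec 0 0 (x 2), rfl, ⟨rfl, rfl⟩, ?_⟩
    ext <;> simp

theorem isAdIrreducible_horizontalPlane : IsAdIrreducible horizontalPlane := by
  refine ⟨fun h => ?_, fun R x hx => hx, fun W hW hinv => ?_⟩
  · have : Heis.vec 1 0 0 ∈ horizontalPlane := rfl
    rw [h, Submodule.mem_bot] at this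
    simpa using congrFun this 0
  · rw [or_iff_not_imp_left, Submodule.eq_bot_iff]
    intro h
    push Not at h
    obtain ⟨w, hw, hw0⟩ := h
    refine le_antisymm hW fun x hx => ?_
    have hw2 : w 2 = 0 := hW hw
    have hx2 : x 2 = 0 := hx
    have hr : w 0 ^ 2 + w 1 ^ 2 ≠ 0 := by
      have h := scalarProduct_self_pos one_pos hw0
      rw [scalarProduct_apply, hw2] at h
      nlinarith
    have hJ := hinv (rotation (Real.pi / 2)) w hw
    -- The vector w and its quarter turn form an orthogonal basis of the plane; these are the
    -- coordinates of x in it.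
    have : x = ((x 0 * w 0 + x 1 * w 1) / (w 0 ^ 2 + w 1 ^ 2)) • w +
        ((x 1 * w 0 - x 0 * w 1) / (w 0 ^ 2 + w 1 ^ 2)) • rotFun (rotation (Real.pi / 2)) w := by
      ext
      · simp
        field_simp
        ring
      · simp
        field_simp
        ring
      · simp [hw2, hx2]
    rw [this]
    exact W.add_mem (W.smul_mem _ hw) (W.smul_mem _ hJ)

theorem isAdIrreducible_verticalLine : IsAdIrreducible verticalLine := by
  refine ⟨fun h => ?_, fun R x hx => ?_, fun W hW _ => ?_⟩
  · have : Heis.vec 0 0 1 ∈ verticalLine := ⟨rfl, rfl⟩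
    rw [h, Submodule.mem_bot] at this
    simpa using congrFun this 2
  · rw [mem_verticalLine] at hx ⊢
    simp [hx.1, hx.2]
  · rw [or_iff_not_imp_left, Submodule.eq_bot_iff]
    intro h
    push Not at h
    obtain ⟨w, hw, hw0⟩ := h
    refine le_antisymm hW fun x hx => ?_
    have hwv := mem_verticalLine.1 (hW hw)
    rw [mem_verticalLine] at hx
    have hw2 : w 2 ≠ 0 := fun h => hw0 (Heis.ext hwv.1 hwv.2 h)
    have : x = (x 2 / w 2) • w := by
      ext
      · simp [hx.1, hwv.1]
      · simp [hx.2, hwv.2]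
      · simp [hw2]
    rw [this]
    exact W.smul_mem _ hw

theorem isInvariantScalarProductOn_scalarProduct {c : ℝ} (hc : 0 < c) (V : Submodule ℝ Heis) :
    IsInvariantScalarProductOn (scalarProduct c) V where
  symm x _ y _ := by simp only [scalarProduct_apply]; ring
  pos x _ hx := scalarProduct_self_pos hc hx
  invariant R x _ y _ := scalarProduct_rotFun c R x y

/-- On a sum of a horizontal and a vertical vector with squared lengths s and t, Fᵢ² = s + cᵢ t.
Because cᵢ > 0, both are positive away from s = t = 0, even on the boundary of the quadrant. Thus L
is evaluated only where it is smooth and positive, and smoothness holds up to the boundary. -/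
theorem IsAdmissible.isAlphaType {c₁ c₂ : ℝ} {L : ℝ × ℝ → ℝ} (hL : IsAdmissible L)
    (h₁ : 0 < c₁) (h₂ : 0 < c₂) : IsAlphaType (combinedNorm c₁ c₂ L) := by
  refine ⟨horizontalPlane, verticalLine, scalarProduct 1, scalarProduct 1,
    fun p => √(L (√(p.1 + c₁ * p.2), √(p.1 + c₂ * p.2))), isCompl_horizontal_vertical,
    isAdIrreducible_horizontalPlane, isAdIrreducible_verticalLine,
    isInvariantScalarProductOn_scalarProduct one_pos _,
    isInvariantScalarProductOn_scalarProduct one_pos _, ?_, ?_, ?_⟩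
  · refine Continuous.comp_continuousOn Real.continuous_sqrt ?_
    refine hL.continuousOn.comp (Continuous.continuousOn (by fun_prop)) fun p _ => ?_
    exact ⟨Real.sqrt_nonneg _, Real.sqrt_nonneg _⟩
  · rintro ⟨s, t⟩ ⟨⟨hs, ht⟩, h0⟩
    refine ContDiffAt.contDiffWithinAt ?_
    have hpos : ∀ c : ℝ, 0 < c → 0 < s + c * t := by
      intro c hc
      rcases (Set.mem_Ici.1 hs).eq_or_lt with h | h
      · rcases (Set.mem_Ici.1 ht).eq_or_lt with h' | h'
        · exact absurd (Prod.ext h.symm h'.symm) h0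
        · exact add_pos_of_nonneg_of_pos hs (mul_pos hc h')
      · exact add_pos_of_pos_of_nonneg h (mul_nonneg hc.le ht)
    have hq : ((√(s + c₁ * t), √(s + c₂ * t)) : ℝ × ℝ) ∈
        Set.Ioi (0 : ℝ) ×ˢ Set.Ioi (0 : ℝ) :=
      ⟨Real.sqrt_pos.2 (hpos c₁ h₁), Real.sqrt_pos.2 (hpos c₂ h₂)⟩
    have hc : ∀ c : ℝ, 0 < c →
        ContDiffAt ℝ ∞ (fun p : ℝ × ℝ => √(p.1 + c * p.2)) (s, t) := fun c hc =>
      (contDiffAt_fst.add (contDiffAt_const.mul contDiffAt_snd)).sqrt (hpos c hc).ne'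
    exact (ContDiffAt.comp (s, t)
      (f := fun p : ℝ × ℝ => ((√(p.1 + c₁ * p.2), √(p.1 + c₂ * p.2)) : ℝ × ℝ))
      (hL.contDiffAt hq) ((hc c₁ h₁).prodMk (hc c₂ h₂))).sqrt (hL.pos _ hq).ne'
  · intro x hx y hy
    rw [mem_horizontalPlane] at hx
    rw [mem_verticalLine] at hy
    have e : ∀ c : ℝ, normOf c (x + y) = √(scalarProduct 1 x x + c * scalarProduct 1 y y) := by
      intro c
      rw [normOf]
      congr 1
      simp only [scalarProduct_apply, heis_add_apply, hx, hy.1, hy.2]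
      ring
    rw [combinedNorm, e, e]

/-! The function `L(a, b) = (a³ + b³)^(2/3)`. -/

theorem hasFDerivAt_cubicL {q : ℝ × ℝ} (hq : q ∈ Set.Ioi (0 : ℝ) ×ˢ Set.Ioi (0 : ℝ)) :
    HasFDerivAt cubicL ((2 * (q.1 ^ 3 + q.2 ^ 3) ^ (-(1 : ℝ) / 3)) •
      (q.1 ^ 2 • ContinuousLinearMap.fst ℝ ℝ ℝ + q.2 ^ 2 • ContinuousLinearMap.snd ℝ ℝ ℝ)) q := by
  have hg : 0 < q.1 ^ 3 + q.2 ^ 3 := add_pos (pow_pos hq.1 3) (pow_pos hq.2 3)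
  have h := ((hasFDerivAt_fst (𝕜 := ℝ) (p := q)).pow 3 |>.add
    ((hasFDerivAt_snd (𝕜 := ℝ) (p := q)).pow 3)).rpow_const (p := (2 : ℝ) / 3) (Or.inl hg.ne')
  refine h.congr_fderiv ?_
  have e : (2 : ℝ) / 3 - 1 = -1 / 3 := by norm_num
  ext <;> simp [e] <;> ring

theorem fderiv_cubicL_apply {q : ℝ × ℝ} (hq : q ∈ Set.Ioi (0 : ℝ) ×ˢ Set.Ioi (0 : ℝ))
    (w : ℝ × ℝ) : fderiv ℝ cubicL q w =
      2 * (q.1 ^ 3 + q.2 ^ 3) ^ (-(1 : ℝ) / 3) * (q.1 ^ 2 * w.1 + q.2 ^ 2 * w.2) := by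
  rw [(hasFDerivAt_cubicL hq).fderiv]
  rfl

theorem partial₁_cubicL {q : ℝ × ℝ} (hq : q ∈ Set.Ioi (0 : ℝ) ×ˢ Set.Ioi (0 : ℝ)) :
    partial₁ cubicL q = 2 * (q.1 ^ 3 + q.2 ^ 3) ^ (-(1 : ℝ) / 3) * q.1 ^ 2 := by
  rw [partial₁, fderiv_cubicL_apply hq]
  ring

theorem partial₂_cubicL {q : ℝ × ℝ} (hq : q ∈ Set.Ioi (0 : ℝ) ×ˢ Set.Ioi (0 : ℝ)) :
    partial₂ cubicL q = 2 * (q.1 ^ 3 + q.2 ^ 3) ^ (-(1 : ℝ) / 3) * q.2 ^ 2 := by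
  rw [partial₂, fderiv_cubicL_apply hq]
  ring

theorem contDiffAt_cubicL {q : ℝ × ℝ} (hq : q ∈ Set.Ioi (0 : ℝ) ×ˢ Set.Ioi (0 : ℝ)) :
    ContDiffAt ℝ ∞ cubicL q := by
  have hg : 0 < q.1 ^ 3 + q.2 ^ 3 := add_pos (pow_pos hq.1 3) (pow_pos hq.2 3)
  exact ((contDiffAt_fst.pow 3).add (contDiffAt_snd.pow 3)).rpow_const_of_ne hg.ne'

/-- With g = a³ + b³, ℓ = a²w₁ + b²w₂ and Q = a w₁² + b w₂², the second derivative is 2 g^(−4/3) (2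
g Q − ℓ²), and weighted Cauchy–Schwarz gives ℓ² ≤ g Q. -/
theorem hessian_cubicL_nonneg {q : ℝ × ℝ} (hq : q ∈ Set.Ioi (0 : ℝ) ×ˢ Set.Ioi (0 : ℝ))
    (w : ℝ × ℝ) : 0 ≤ iteratedFDeriv ℝ 2 cubicL q ![w, w] := by
  rw [iteratedFDeriv_two_apply]
  simp only [Matrix.cons_val_zero, Matrix.cons_val_one]
  have hq1 : 0 < q.1 := hq.1
  have hq2 : 0 < q.2 := hq.2
  have hg : 0 < q.1 ^ 3 + q.2 ^ 3 := by positivity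
  have hline : HasDerivAt (fun t : ℝ => q + t • w) w 0 := by
    simpa using ((hasDerivAt_id (0 : ℝ)).smul_const w).const_add q
  have hq' : q + (0 : ℝ) • w = q := by simp
  have hd : HasFDerivAt (fderiv ℝ cubicL) (fderiv ℝ (fderiv ℝ cubicL) q) q :=
    (((contDiffAt_cubicL hq).fderiv_right (m := ∞) (by simp)).differentiableAt
      (by simp)).hasFDerivAt
  have hA : HasDerivAt (fun t : ℝ => fderiv ℝ cubicL (q + t • w) w)
      (fderiv ℝ (fderiv ℝ cubicL) q w w) 0 := by
    have h := HasFDerivAt.comp_hasDerivAt (0 : ℝ) (f := fun t : ℝ => q + t • w)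
      (by rw [hq']; exact hd) hline
    simpa using h.clm_apply (hasDerivAt_const (0 : ℝ) w)
  have ha : HasDerivAt (fun t : ℝ => q.1 + t * w.1) w.1 0 := by
    simpa using ((hasDerivAt_id (0 : ℝ)).mul_const w.1).const_add q.1
  have hb : HasDerivAt (fun t : ℝ => q.2 + t * w.2) w.2 0 := by
    simpa using ((hasDerivAt_id (0 : ℝ)).mul_const w.2).const_add q.2
  have hgt := ((ha.fun_pow 3).fun_add (hb.fun_pow 3)).rpow_const (p := -(1 : ℝ) / 3)
    (Or.inl (by simpa using hg.ne'))
  have hB := (hgt.const_mul 2).mul (((ha.fun_pow 2).mul_const w.1).fun_add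
    ((hb.fun_pow 2).mul_const w.2))
  have key := hA.unique (hB.congr_of_eventuallyEq (by
    have : ∀ᶠ t : ℝ in nhds 0, q + t • w ∈ Set.Ioi (0 : ℝ) ×ˢ Set.Ioi (0 : ℝ) :=
      hline.continuousAt.eventually_mem (by rw [hq']; exact isOpen_quadrant.mem_nhds hq)
    filter_upwards [this] with t ht
    rw [fderiv_cubicL_apply ht]
    rfl))
  rw [key]
  have e : (q.1 ^ 3 + q.2 ^ 3) ^ (-(1 : ℝ) / 3) =
      (q.1 ^ 3 + q.2 ^ 3) ^ (-(1 : ℝ) / 3 - 1) * (q.1 ^ 3 + q.2 ^ 3) := by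
    rw [← Real.rpow_add_one hg.ne', sub_add_cancel]
  simp only [zero_mul, add_zero]
  rw [e]
  have hP : 0 < (q.1 ^ 3 + q.2 ^ 3) ^ (-(1 : ℝ) / 3 - 1) := Real.rpow_pos_of_pos hg _
  generalize (q.1 ^ 3 + q.2 ^ 3) ^ (-(1 : ℝ) / 3 - 1) = P at hP
  -- Lagrange's identity: the Cauchy–Schwarz defect is an explicit square with a positive weight.
  have hcs : (q.1 ^ 2 * w.1 + q.2 ^ 2 * w.2) ^ 2 + q.1 * q.2 * (q.2 * w.1 - q.1 * w.2) ^ 2 =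
      (q.1 ^ 3 + q.2 ^ 3) * (q.1 * w.1 ^ 2 + q.2 * w.2 ^ 2) := by ring
  have hn : 0 ≤ q.1 * q.2 * (q.2 * w.1 - q.1 * w.2) ^ 2 := by positivity
  have hn' : 0 ≤ (q.1 ^ 3 + q.2 ^ 3) * (q.1 * w.1 ^ 2 + q.2 * w.2 ^ 2) := by positivity
  have hfin : 0 ≤ 2 * P * (2 * ((q.1 ^ 3 + q.2 ^ 3) * (q.1 * w.1 ^ 2 + q.2 * w.2 ^ 2)) -
      (q.1 ^ 2 * w.1 + q.2 ^ 2 * w.2) ^ 2) := mul_nonneg (by positivity) (by linarith)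
  refine hfin.trans_eq ?_
  norm_num
  ring

theorem isAdmissible_cubicL : IsAdmissible cubicL where
  continuousOn := by
    have : Continuous cubicL :=
      Continuous.rpow_const (by fun_prop) fun _ => Or.inr (by norm_num)
    exact this.continuousOn
  smooth q hq := (contDiffAt_cubicL hq).contDiffWithinAt
  pos q hq := Real.rpow_pos_of_pos (add_pos (pow_pos hq.1 3) (pow_pos hq.2 3)) _
  homogeneous q hq r hr := by
    have hq1 : 0 ≤ q.1 := hq.1
    have hq2 : 0 ≤ q.2 := hq.2
    have e : (r • q).1 ^ 3 + (r • q).2 ^ 3 = r ^ 3 * (q.1 ^ 3 + q.2 ^ 3) := by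
      simp only [Prod.smul_fst, Prod.smul_snd, smul_eq_mul]
      ring
    rw [cubicL, e, Real.mul_rpow (by positivity) (by positivity), cubicL]
    congr 1
    rw [← Real.rpow_natCast r 3, ← Real.rpow_mul hr, ← Real.rpow_natCast r 2]
    norm_num
  partial₁_nonneg q hq := by
    have hg : 0 < q.1 ^ 3 + q.2 ^ 3 := add_pos (pow_pos hq.1 3) (pow_pos hq.2 3)
    rw [partial₁_cubicL hq]
    positivity
  partial₂_nonneg q hq := by
    have hg : 0 < q.1 ^ 3 + q.2 ^ 3 := add_pos (pow_pos hq.1 3) (pow_pos hq.2 3)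
    rw [partial₂_cubicL hq]
    positivity
  hessian_nonneg q hq w := hessian_cubicL_nonneg hq w
  partial_sum_pos q hq := by
    have hq1 : 0 < q.1 := hq.1
    have hq2 : 0 < q.2 := hq.2
    rw [partial₁_cubicL hq, partial₂_cubicL hq]
    positivity

theorem combinedNorm_cubicL (c₁ c₂ : ℝ) (y : Heis) : combinedNorm c₁ c₂ cubicL y =
    (normOf c₁ y ^ 3 + normOf c₂ y ^ 3) ^ ((1 : ℝ) / 3) := by
  have h1 := normOf_nonneg c₁ y
  have h2 := normOf_nonneg c₂ y
  rw [combinedNorm, cubicL, Real.sqrt_eq_rpow, ← Real.rpow_mul (by positivity)]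
  norm_num

/-- Here L,ᵢ is a common factor times Fᵢ², so Bᵢ is proportional to Fᵢ and the factor cancels. At y
= 0 both sides vanish because y₃ = 0. -/
theorem graphOf_cubicL {c₁ c₂ : ℝ} (h₁ : 0 < c₁) (h₂ : 0 < c₂) :
    graphOf c₁ c₂ cubicL = fun y : Heis =>
      (c₁ * normOf c₁ y + c₂ * normOf c₂ y) / (normOf c₁ y + normOf c₂ y) * y 2 := by
  funext y
  rcases eq_or_ne y 0 with rfl | hy
  · simp [graphOf]
  have hq := normPair_mem h₁ h₂ hy
  have p₁ := normOf_pos h₁ hy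
  have p₂ := normOf_pos h₂ hy
  have hP : 0 < (normOf c₁ y ^ 3 + normOf c₂ y ^ 3) ^ (-(1 : ℝ) / 3) :=
    Real.rpow_pos_of_pos (by positivity) _
  have e₁ := partial₁_cubicL hq
  have e₂ := partial₂_cubicL hq
  simp only [normPair] at e₁ e₂
  simp only [graphOf, e₁, e₂]
  generalize (normOf c₁ y ^ 3 + normOf c₂ y ^ 3) ^ (-(1 : ℝ) / 3) = P at hP
  congr 1
  field_simp

/-- Nothing is assumed about ξ on the E₃-axis, so its unknown value at 2E₃ is eliminated: by
additivity and evenness in s it equals 2 ξ(sE₁ + E₃) for every s ≠ 0. Comparing s = 1 with s = 2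
then contradicts c₁ ≠ c₂. -/
theorem not_isLinearMap_of_eq_cubic {c₁ c₂ : ℝ} (h₁ : 0 < c₁) (h₂ : 0 < c₂) (hc : c₁ ≠ c₂)
    {ξ : Heis → ℝ} (hξ : ∀ y : Heis, (y 0 ≠ 0 ∨ y 1 ≠ 0) → ξ y =
      (c₁ * normOf c₁ y + c₂ * normOf c₂ y) / (normOf c₁ y + normOf c₂ y) * y 2) :
    ¬ IsLinearMap ℝ ξ := by
  intro hlin
  have hpair : ∀ s : ℝ, s ≠ 0 → 2 * ξ (Heis.vec s 0 1) = ξ (Heis.vec 0 0 2) := by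
    intro s hs
    have hsym : ξ (Heis.vec (-s) 0 1) = ξ (Heis.vec s 0 1) := by
      have e : ∀ c, normOf c (Heis.vec (-s) 0 1) = normOf c (Heis.vec s 0 1) := fun c =>
        normOf_congr c (by simp) rfl
      rw [hξ _ (Or.inl (by simpa using hs)), hξ _ (Or.inl (by simpa using hs)), e, e]
      simp
    have hadd := hlin.map_add (Heis.vec s 0 1) (Heis.vec (-s) 0 1)
    rw [hsym, ← two_mul] at hadd
    rw [← hadd]
    congr 1
    ext <;> simp
    norm_num
  have hval : ξ (Heis.vec 1 0 1) = ξ (Heis.vec 2 0 1) := by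
    have := (hpair 1 one_ne_zero).trans (hpair 2 two_ne_zero).symm
    linarith
  rw [hξ _ (Or.inl (by simp)), hξ _ (Or.inl (by simp))] at hval
  have hne : ∀ s : ℝ, Heis.vec s 0 1 ≠ 0 := fun s h => by simpa using congrFun h 2
  have hsq : ∀ c : ℝ, 0 < c → ∀ s : ℝ, normOf c (Heis.vec s 0 1) ^ 2 = s ^ 2 + c := by
    intro c hc s
    rw [normOf_sq hc, scalarProduct_apply]
    simp
    ring
  have a1 := normOf_pos h₁ (hne 1)
  have a2 := normOf_pos h₁ (hne 2)
  have b1 := normOf_pos h₂ (hne 1)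
  have b2 := normOf_pos h₂ (hne 2)
  have sa1 := hsq c₁ h₁ 1
  have sa2 := hsq c₁ h₁ 2
  have sb1 := hsq c₂ h₂ 1
  have sb2 := hsq c₂ h₂ 2
  set A := normOf c₁ (Heis.vec 1 0 1)
  set A' := normOf c₁ (Heis.vec 2 0 1)
  set B := normOf c₂ (Heis.vec 1 0 1)
  set B' := normOf c₂ (Heis.vec 2 0 1)
  simp only [Heis.vec_two, mul_one] at hval
  rw [div_eq_div_iff (by positivity) (by positivity)] at hval
  -- After clearing denominators, the equality of the two weighted means reads (c₁ − c₂)(A B' − B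
  -- A') = 0. Squaring then gives (1 + c₁)(4 + c₂) = (1 + c₂)(4 + c₁), that is, c₁ = c₂.
  have hcross : A * B' = B * A' := by
    apply mul_left_cancel₀ (sub_ne_zero.2 hc)
    linear_combination hval
  have hcross2 : A ^ 2 * B' ^ 2 = B ^ 2 * A' ^ 2 := by
    rw [← mul_pow, hcross, mul_pow]
  rw [sa1, sa2, sb1, sb2] at hcross2
  exact hc (by linarith)

end HeisFinsler

end

theorem corollary1 (c₁ c₂ : ℝ) (hc₁ : 0 < c₁) (hc₂ : 0 < c₂) (hc : c₁ ≠ c₂) :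
    -- the two Riemannian metrics are naturally reductive
    (IsNaturallyReductiveRiemannian (scalarProduct c₁) ∧
      IsNaturallyReductiveRiemannian (scalarProduct c₂)) ∧
    -- each admissible `L` gives a geodesic orbit Finsler metric of `(α₁, α₂)`-type
    (∀ L : ℝ × ℝ → ℝ, IsAdmissible L →
      IsHomogeneousFinsler (invariantMetric (combinedNorm c₁ c₂ L)) ∧
      IsAlphaType (combinedNorm c₁ c₂ L) ∧
      IsGeodesicOrbit (invariantMetric (combinedNorm c₁ c₂ L)) ∧
      IsUniqueGeodesicGraph (invariantMetric (combinedNorm c₁ c₂ L)) (graphOf c₁ c₂ L) ∧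
      (¬ IsLinearMap ℝ (graphOf c₁ c₂ L) →
        ¬ IsNaturallyReductive (invariantMetric (combinedNorm c₁ c₂ L)))) ∧
    -- the example `F = (F₁³ + F₂³)^(1/3)`
    IsAdmissible cubicL ∧
    (∀ y : Heis, combinedNorm c₁ c₂ cubicL y =
      (normOf c₁ y ^ 3 + normOf c₂ y ^ 3) ^ ((1 : ℝ) / 3)) ∧
    IsUniqueGeodesicGraph (invariantMetric (combinedNorm c₁ c₂ cubicL))
      (fun y : Heis => (c₁ * normOf c₁ y + c₂ * normOf c₂ y) / (normOf c₁ y + normOf c₂ y) * y 2) ∧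
    (∀ ξ : Heis → ℝ, IsGeodesicGraph (invariantMetric (combinedNorm c₁ c₂ cubicL)) ξ →
      ¬ IsLinearMap ℝ ξ) ∧
    ¬ IsNaturallyReductive (invariantMetric (combinedNorm c₁ c₂ cubicL)) := by
  have hgraph := isAdmissible_cubicL.isUniqueGeodesicGraph hc₁ hc₂
  rw [graphOf_cubicL hc₁ hc₂] at hgraph
  refine ⟨⟨isNaturallyReductiveRiemannian_scalarProduct hc₁,
    isNaturallyReductiveRiemannian_scalarProduct hc₂⟩, fun L hL =>
    ⟨hL.isHomogeneousFinsler hc₁ hc₂, hL.isAlphaType hc₁ hc₂, hL.isGeodesicOrbit hc₁ hc₂,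
      hL.isUniqueGeodesicGraph hc₁ hc₂, mt (hL.isLinearMap_graphOf hc₁ hc₂)⟩,
    isAdmissible_cubicL, combinedNorm_cubicL c₁ c₂, hgraph, fun ξ hξ => ?_, fun h => ?_⟩
  · exact not_isLinearMap_of_eq_cubic hc₁ hc₂ hc (hgraph.2.2 ξ hξ)
  · have hlin := isAdmissible_cubicL.isLinearMap_graphOf hc₁ hc₂ h
    rw [graphOf_cubicL hc₁ hc₂] at hlin
    exact not_isLinearMap_of_eq_cubic hc₁ hc₂ hc (fun _ _ => rfl) hlin
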